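/- Let $a<b$, $r\in\mathbb N$, $\mathcal H=L^2((a,b);\mathbb C^r)$, and let $x\cdot y$ be the scalar product on $\mathbb C^r$, linear in the first and antilinear in the second entry. Let $\mathbf A\in W^{1,\infty}((a,b);\mathbb C^{r\times r})$ be Hermitian-valued (identified with its continuous representative on $[a,b]$) and $\mathbf B\in L^\infty((a,b);\mathbb C^{r\times r})$, with $\mathbf B+\mathbf B^*+\mathbf A'\ge 2\mu_0 I$ a.e. on $(a,b)$ for some $\mu_0>0$. Define on $C_c^\infty((a,b);\mathbb C^r)\subset\mathcal H$ the operators $$T\varphi=(\mathbf A\varphi)'+\mathbf B\varphi,\qquad \widetilde T\varphi=-(\mathbf A\varphi)'+(\mathbf B^*+\mathbf A')\varphi,$$ let $T_0=\overline T$, $\widetilde T_0=\overline{\widetilde T}$ be their closures and $T_1=\widetilde T^*$, $\widetilde T_1=T^*$. The graph space is $\mathcal W=\{u\in\mathcal H:(\mathbf Au)'\in\mathcal H\}$ (weak derivative), which is equal to $\operatorname{dom}T_1=\operatorname{dom}\widetilde T_1$, and the boundary form is $$[u\mid v]=\langle T_1u,v\rangle_{\mathcal H}-\langle u,\widetilde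 T_1v\rangle_{\mathcal H},\qquad u,v\in\mathcal W.$$ For $x_0\in\{a,b\}$ and a nonzero eigenvalue $\lambda$ of $\mathbf A(x_0)$, let $\mathbf P_\lambda(x)$, for $x\in[a,b]$ close to $x_0$, be the total projection for the $\lambda$-group, that is, the sum of the eigenprojections of all distinct eigenvalues of $\mathbf A(x)$ inside a fixed circle centred at $\lambda$ such that $\lambda$ is the only eigenvalue of $\mathbf A(x_0)$ on or inside the circle. For every $u\in\mathcal W$ the function $x\mapsto\mathbf P_\lambda(x)u(x)$ has a continuous representative on a neighbourhood of $x_0$ in $[a,b]$, and its value at $x_0$, which does not depend on the circle, is denoted by $(\mathbf P_\lambda u)(x_0)$. Write $\sigma(M)$ for the set of eigenvalues of a matrix $M$. Then: (i) for all $u,v\in\mathcal W$, $$[u\mid v]=\sum_{\lambda\in\sigma(\mathbf A(b))\setminus\{0\}}\lambda\,(\mathbf P_\lambda u)(b)\cdot(\mathbf P_\lambda v)(b)-\sum_{\lambda\in\sigma(\mathbf A(a))\setminus\{0\}}\lambda\,(\mathbf P_\lambda u)(a)\cdot(\mathbf P_\lambda v)(a);$$ (ii) $\operatorname{dom}T_0=\operatorname{dom}\widetilde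 T_0=\mathcal W_0$, where $$\mathcal W_0=\{u\in\mathcal W:\ (\mathbf P_\lambda u)(x)=0\ \text{ for all } x\in\{a,b\}\text{ and all }\lambda\in\sigma(\mathbf A(x))\setminus\{0\}\}.$$ -/

import Mathlib

open MeasureTheory Set
open scoped Distributions ENNReal ComplexOrder

noncomputable section

/-- The space `ℂ^r` with its Euclidean norm. -/
abbrev Cvec (r : ℕ) : Type := EuclideanSpace ℂ (Fin r)

/-- The scalar product, linear in the first and antilinear in the second entry. -/
def scp {H : Type*} [NormedAddCommGroup H] [InnerProductSpace ℂ H] (u v : H) : ℂ :=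
  inner ℂ v u

/-- Action of a matrix on `ℂ^r`. -/
def mact {r : ℕ} (M : Matrix (Fin r) (Fin r) ℂ) (v : Cvec r) : Cvec r :=
  Matrix.toEuclideanLin M v

/-- The open interval `(a, b)` as an open set. -/
def openIoo (a b : ℝ) : TopologicalSpace.Opens ℝ := ⟨Ioo a b, isOpen_Ioo⟩

/-- Lebesgue measure on `(a, b)`. -/
abbrev intervalMeasure (a b : ℝ) : Measure ℝ := volume.restrict (Ioo a b)

/-- The Hilbert space `L²((a, b); ℂ^r)`. -/
abbrev L2Space (a b : ℝ) (r : ℕ) : Type := Lp (Cvec r) 2 (intervalMeasure a b)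

/-- `g` is the weak (distributional) derivative of `f` on `(a, b)`. -/
def IsWeakDeriv {F : Type*} [NormedAddCommGroup F] [NormedSpace ℝ F] (a b : ℝ)
    (f g : ℝ → F) : Prop :=
  LocallyIntegrableOn f (Ioo a b) ∧ LocallyIntegrableOn g (Ioo a b) ∧
    ∀ φ : 𝓓(openIoo a b, ℝ),
      ∫ x in Ioo a b, deriv φ x • f x = - ∫ x in Ioo a b, φ x • g x

/-- Coefficients of a one-dimensional classical Friedrichs operator on `(a, b)`:
a Hermitian matrix function `A ∈ W^{1,∞}`, given by its continuous representative on `[a, b]`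
and by (a representative of) its weak derivative `A' ∈ L^∞`, and a matrix function `B ∈ L^∞`,
with `B + B* + A' ≥ 2 μ₀ I` almost everywhere for some `μ₀ > 0`. -/
structure FriedrichsCoeff (a b : ℝ) (r : ℕ) where
  /-- the leading coefficient -/
  A : ℝ → Matrix (Fin r) (Fin r) ℂ
  /-- its weak derivative -/
  A' : ℝ → Matrix (Fin r) (Fin r) ℂ
  /-- the zeroth order coefficient -/
  B : ℝ → Matrix (Fin r) (Fin r) ℂ
  continuousOn_A : ContinuousOn A (Icc a b)
  weakDeriv_A : ∀ i j, IsWeakDeriv a b (fun x => A x i j) (fun x => A' x i j)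
  memLp_A' : ∀ i j, MemLp (fun x => A' x i j) ∞ (intervalMeasure a b)
  memLp_B : ∀ i j, MemLp (fun x => B x i j) ∞ (intervalMeasure a b)
  hermitian_A : ∀ x ∈ Ioo a b, (A x).IsHermitian
  positive : ∃ μ₀ : ℝ, 0 < μ₀ ∧ ∀ᵐ x ∂(intervalMeasure a b),
    (B x + (B x).conjTranspose + A' x
      - ((2 * μ₀ : ℝ) : ℂ) • (1 : Matrix (Fin r) (Fin r) ℂ)).PosSemidef

/-! ### Facts needed to see that the operators take values in `L²` -/

theorem mact_apply {r : ℕ} (M : Matrix (Fin r) (Fin r) ℂ) (v : Cvec r) (i : Fin r) :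
    mact M v i = ∑ j, M i j * v j := by
  simp [mact, Matrix.toLpLin_apply, Matrix.mulVec, dotProduct]

theorem memLp_mact {r : ℕ} {μ : Measure ℝ} {M : ℝ → Matrix (Fin r) (Fin r) ℂ}
    {f : ℝ → Cvec r} (hM : ∀ i j, MemLp (fun x => M x i j) ∞ μ) (hf : MemLp f 2 μ) :
    MemLp (fun x => mact (M x) (f x)) 2 μ := by
  refine MemLp.of_eval_piLp fun i => ?_
  simp only [mact_apply]
  exact memLp_finsetSum _ fun j _ => (hf.eval_piLp j).mul (hM i j)

theorem memLp_testFunction {a b : ℝ} {r : ℕ} (φ : 𝓓(openIoo a b, Cvec r)) :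
    MemLp (φ : ℝ → Cvec r) 2 (intervalMeasure a b) :=
  (φ.continuous.memLp_of_hasCompactSupport φ.hasCompactSupport).restrict _

theorem memLp_deriv_testFunction {a b : ℝ} {r : ℕ} (φ : 𝓓(openIoo a b, Cvec r)) :
    MemLp (deriv (φ : ℝ → Cvec r)) 2 (intervalMeasure a b) :=
  ((φ.contDiff.continuous_deriv (by simp)).memLp_of_hasCompactSupport
    φ.hasCompactSupport.deriv).restrict _

theorem differentiable_testFunction {a b : ℝ} {r : ℕ} (φ : 𝓓(openIoo a b, Cvec r)) :
    Differentiable ℝ (φ : ℝ → Cvec r) :=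
  φ.contDiff.differentiable (by simp)

theorem deriv_testFunction_add {a b : ℝ} {r : ℕ} (φ ψ : 𝓓(openIoo a b, Cvec r)) (x : ℝ) :
    deriv ((φ + ψ : 𝓓(openIoo a b, Cvec r)) : ℝ → Cvec r) x = deriv φ x + deriv ψ x :=
  deriv_add (differentiable_testFunction φ x) (differentiable_testFunction ψ x)

theorem deriv_testFunction_smul {a b : ℝ} {r : ℕ} (c : ℂ) (φ : 𝓓(openIoo a b, Cvec r)) (x : ℝ) :
    deriv ((c • φ : 𝓓(openIoo a b, Cvec r)) : ℝ → Cvec r) x = c • deriv φ x :=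
  deriv_const_smul c (differentiable_testFunction φ x)

/-- A test function is determined by its class in `L²`. -/
theorem testFunction_eq_of_ae_eq {a b : ℝ} {r : ℕ} {φ ψ : 𝓓(openIoo a b, Cvec r)}
    (h : (φ : ℝ → Cvec r) =ᵐ[intervalMeasure a b] ψ) : φ = ψ := by
  have h1 : EqOn (φ : ℝ → Cvec r) ψ (Ioo a b) :=
    Measure.eqOn_open_of_ae_eq h isOpen_Ioo φ.continuous.continuousOn ψ.continuous.continuousOn
  ext1 x
  by_cases hx : x ∈ Ioo a b
  · exact h1 hx
  · rw [image_eq_zero_of_notMem_tsupport fun h => hx (φ.tsupport_subset h),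
      image_eq_zero_of_notMem_tsupport fun h => hx (ψ.tsupport_subset h)]

/-- The embedding of `C_c^∞((a, b); ℂ^r)` into `L²((a, b); ℂ^r)`. -/
def testToL2 (a b : ℝ) (r : ℕ) : 𝓓(openIoo a b, Cvec r) →ₗ[ℂ] L2Space a b r where
  toFun φ := (memLp_testFunction φ).toLp φ
  map_add' φ ψ := (memLp_testFunction φ).toLp_add (memLp_testFunction ψ)
  map_smul' c φ := (memLp_testFunction φ).toLp_const_smul c

theorem testToL2_injective (a b : ℝ) (r : ℕ) : Function.Injective (testToL2 a b r) := by
  intro φ ψ h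
  exact testFunction_eq_of_ae_eq
    ((MemLp.toLp_eq_toLp_iff (memLp_testFunction φ) (memLp_testFunction ψ)).1 h)

/-- An operator given on test functions, regarded as a partially defined operator on `L²`
with domain (the classes of) `C_c^∞((a, b); ℂ^r)`. -/
def opOnTest {a b : ℝ} {r : ℕ} (L : 𝓓(openIoo a b, Cvec r) →ₗ[ℂ] L2Space a b r) :
    L2Space a b r →ₗ.[ℂ] L2Space a b r where
  domain := LinearMap.range (testToL2 a b r)
  toFun := L ∘ₗ (LinearEquiv.ofInjective (testToL2 a b r)
    (testToL2_injective a b r)).symm.toLinearMap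

namespace FriedrichsCoeff

variable {a b : ℝ} {r : ℕ} (S : FriedrichsCoeff a b r)

theorem memLp_A (i j : Fin r) : MemLp (fun x => S.A x i j) ∞ (intervalMeasure a b) := by
  have hc : ContinuousOn (fun x => S.A x i j) (Icc a b) := fun x hx =>
    ((continuous_id.matrix_elem i j).tendsto (S.A x)).comp (S.continuousOn_A x hx)
  obtain ⟨C, hC⟩ := isCompact_Icc.exists_bound_of_continuousOn hc
  refine memLp_top_of_bound
    ((hc.mono Ioo_subset_Icc_self).aestronglyMeasurable measurableSet_Ioo) C ?_
  exact (ae_restrict_iff' measurableSet_Ioo).2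
    (Filter.Eventually.of_forall fun x hx => hC x (Ioo_subset_Icc_self hx))

/-- The function `(A φ)' = A φ' + A' φ` for a test function `φ`. -/
def derivA (φ : 𝓓(openIoo a b, Cvec r)) (x : ℝ) : Cvec r :=
  mact (S.A x) (deriv φ x) + mact (S.A' x) (φ x)

/-- The function `(A φ)' + B φ`. -/
def opFun (φ : 𝓓(openIoo a b, Cvec r)) (x : ℝ) : Cvec r :=
  S.derivA φ x + mact (S.B x) (φ x)

/-- The function `-(A φ)' + (B* + A') φ`. -/
def opFunTilde (φ : 𝓓(openIoo a b, Cvec r)) (x : ℝ) : Cvec r :=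
  - S.derivA φ x + mact ((S.B x).conjTranspose + S.A' x) (φ x)

theorem memLp_derivA (φ : 𝓓(openIoo a b, Cvec r)) :
    MemLp (S.derivA φ) 2 (intervalMeasure a b) :=
  (memLp_mact S.memLp_A (memLp_deriv_testFunction φ)).add
    (memLp_mact S.memLp_A' (memLp_testFunction φ))

theorem memLp_opFun (φ : 𝓓(openIoo a b, Cvec r)) :
    MemLp (S.opFun φ) 2 (intervalMeasure a b) :=
  (S.memLp_derivA φ).add (memLp_mact S.memLp_B (memLp_testFunction φ))

theorem memLp_opFunTilde (φ : 𝓓(openIoo a b, Cvec r)) :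
    MemLp (S.opFunTilde φ) 2 (intervalMeasure a b) := by
  refine (S.memLp_derivA φ).neg.add (memLp_mact (fun i j => ?_) (memLp_testFunction φ))
  exact (S.memLp_B j i).star.add (S.memLp_A' i j)

theorem derivA_add (φ ψ : 𝓓(openIoo a b, Cvec r)) :
    S.derivA (φ + ψ) = S.derivA φ + S.derivA ψ := by
  funext x
  simp only [derivA, deriv_testFunction_add, _root_.add_apply, Pi.add_apply, mact, map_add]
  abel

theorem derivA_smul (c : ℂ) (φ : 𝓓(openIoo a b, Cvec r)) :
    S.derivA (c • φ) = c • S.derivA φ := by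
  funext x
  simp only [derivA, deriv_testFunction_smul, _root_.smul_apply, Pi.smul_apply, mact, map_smul,
    smul_add]

theorem opFun_add (φ ψ : 𝓓(openIoo a b, Cvec r)) :
    S.opFun (φ + ψ) = S.opFun φ + S.opFun ψ := by
  funext x
  simp only [opFun, derivA_add, _root_.add_apply, Pi.add_apply, mact, map_add]
  abel

theorem opFun_smul (c : ℂ) (φ : 𝓓(openIoo a b, Cvec r)) :
    S.opFun (c • φ) = c • S.opFun φ := by
  funext x
  simp only [opFun, derivA_smul, _root_.smul_apply, Pi.smul_apply, mact, map_smul, smul_add]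

theorem opFunTilde_add (φ ψ : 𝓓(openIoo a b, Cvec r)) :
    S.opFunTilde (φ + ψ) = S.opFunTilde φ + S.opFunTilde ψ := by
  funext x
  simp only [opFunTilde, derivA_add, _root_.add_apply, Pi.add_apply, mact, map_add,
    LinearMap.add_apply]
  abel

theorem opFunTilde_smul (c : ℂ) (φ : 𝓓(openIoo a b, Cvec r)) :
    S.opFunTilde (c • φ) = c • S.opFunTilde φ := by
  funext x
  simp only [opFunTilde, derivA_smul, _root_.smul_apply, Pi.smul_apply, mact, map_smul,
    smul_add, smul_neg]

/-- The operator `T φ = (A φ)' + B φ` with domain `C_c^∞((a, b); ℂ^r)`. -/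
def T : L2Space a b r →ₗ.[ℂ] L2Space a b r :=
  opOnTest
    { toFun := fun φ => (S.memLp_opFun φ).toLp (S.opFun φ)
      map_add' := fun φ ψ => by
        rw [← MemLp.toLp_add]
        exact MemLp.toLp_congr _ _ (by rw [opFun_add])
      map_smul' := fun c φ => by
        rw [RingHom.id_apply, ← MemLp.toLp_const_smul]
        exact MemLp.toLp_congr _ _ (by rw [opFun_smul]) }

/-- The operator `T̃ φ = -(A φ)' + (B* + A') φ` with domain `C_c^∞((a, b); ℂ^r)`. -/
def Ttilde : L2Space a b r →ₗ.[ℂ] L2Space a b r :=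
  opOnTest
    { toFun := fun φ => (S.memLp_opFunTilde φ).toLp (S.opFunTilde φ)
      map_add' := fun φ ψ => by
        rw [← MemLp.toLp_add]
        exact MemLp.toLp_congr _ _ (by rw [opFunTilde_add])
      map_smul' := fun c φ => by
        rw [RingHom.id_apply, ← MemLp.toLp_const_smul]
        exact MemLp.toLp_congr _ _ (by rw [opFunTilde_smul]) }

/-- `T₀`, the closure of `T`. -/
def T₀ : L2Space a b r →ₗ.[ℂ] L2Space a b r := S.T.closure

/-- `T̃₀`, the closure of `T̃`. -/
def Ttilde₀ : L2Space a b r →ₗ.[ℂ] L2Space a b r := S.Ttilde.closure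

/-- `T₁`, the adjoint of `T̃`. -/
def T₁ : L2Space a b r →ₗ.[ℂ] L2Space a b r := S.Ttilde.adjoint

/-- `T̃₁`, the adjoint of `T`. -/
def Ttilde₁ : L2Space a b r →ₗ.[ℂ] L2Space a b r := S.T.adjoint

/-- The graph space `W = {u ∈ L² : (A u)' ∈ L²}`. -/
def graphSpace : Set (L2Space a b r) :=
  {u | ∃ w : L2Space a b r, IsWeakDeriv a b (fun x => mact (S.A x) (u x)) w}

/-- The boundary form `[u | v] = ⟨T₁ u, v⟩ - ⟨u, T̃₁ v⟩`. -/
def boundaryForm (u : S.T₁.domain) (v : S.Ttilde₁.domain) : ℂ :=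
  scp (S.T₁ u) (v : L2Space a b r) - scp (u : L2Space a b r) (S.Ttilde₁ v)

end FriedrichsCoeff

/-- The nonzero (complex) eigenvalues of a matrix, without repetition. -/
def nonzeroEigenvalues {r : ℕ} (M : Matrix (Fin r) (Fin r) ℂ) : Finset ℂ :=
  ((Matrix.finite_spectrum M).sdiff (t := {0})).toFinset

/-- The orthogonal projection onto the eigenspace `ker (M - μ)`; for Hermitian `M` this is the
eigenprojection of the eigenvalue `μ`. -/
def eigenProj {r : ℕ} (M : Matrix (Fin r) (Fin r) ℂ) (μ : ℂ) : Cvec r →L[ℂ] Cvec r :=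
  (Module.End.eigenspace (Matrix.toEuclideanLin M) μ).starProjection

/-- The sum of the eigenprojections of all eigenvalues of `M` (without repetition)
inside the circle of centre `l` and radius `ρ`. -/
def totalProj {r : ℕ} (M : Matrix (Fin r) (Fin r) ℂ) (l : ℂ) (ρ : ℝ) : Cvec r →L[ℂ] Cvec r :=
  ∑ μ ∈ ((Matrix.finite_spectrum M).inter_of_left (Metric.ball l ρ)).toFinset, eigenProj M μ

/-- The circle of centre `l` and radius `ρ > 0` encloses the eigenvalue `l` of `M`, while no other
eigenvalue of `M` lies on it or inside it. -/
def IsolatesEigenvalue {r : ℕ} (M : Matrix (Fin r) (Fin r) ℂ) (l : ℂ) (ρ : ℝ) : Prop :=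
  0 < ρ ∧ spectrum ℂ M ∩ Metric.closedBall l ρ = {l}

namespace FriedrichsCoeff

variable {a b : ℝ} {r : ℕ} (S : FriedrichsCoeff a b r)

/-- `w` is the value at `x₀` of `P_l u`, where `P_l(x)` is the total projection of `A(x)` onto the
`l`-group, `l` being an eigenvalue of `A(x₀)`: near `x₀` in `[a, b]` the function
`x ↦ P_l(x) u(x)` has a continuous representative, and `w` is the value of the latter at `x₀`.
The `l`-group at `x` close to `x₀` consists of the eigenvalues of `A(x)` inside a circle that
separates `l` from the rest of the spectrum of `A(x₀)`; the choice of the circle is immaterial. -/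
def IsProjValue (u : L2Space a b r) (x₀ : ℝ) (l : ℂ) (w : Cvec r) : Prop :=
  ∀ ρ : ℝ, IsolatesEigenvalue (S.A x₀) l ρ →
    ∃ ε : ℝ, 0 < ε ∧ ∃ g : ℝ → Cvec r,
      ContinuousOn g (Icc a b ∩ Icc (x₀ - ε) (x₀ + ε)) ∧
      (∀ᵐ x ∂(volume.restrict (Ioo a b ∩ Icc (x₀ - ε) (x₀ + ε))),
        g x = totalProj (S.A x) l ρ (u x)) ∧
      g x₀ = w

/-- The evaluation `(P_l u)(x₀)`. -/
def projValue (u : L2Space a b r) (x₀ : ℝ) (l : ℂ) : Cvec r :=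
  Classical.epsilon (S.IsProjValue u x₀ l)

end FriedrichsCoeff

end

noncomputable section

open Filter Topology

/-! For `u` in the graph space, `A u` has a square integrable weak derivative and therefore a
continuous representative `p`, its flux, although `u` itself need not have boundary values where `A`
degenerates. Three ideas turn this into the theorem.

Product rule. If `v` is another such function, with flux `q`, then `A u · v` is weakly
differentiable with integrable derivative `(A u)' · v + u · (A v)' - A' u · v`, which is exactly the
integrand of the boundary form. As neither `u` nor `v` need be differentiable, this is proved with
difference quotients: the identity `inner_sub_inner_of_isHermitian` takes differences of `A u`, `A
v` and `A` only, and the limit follows from the continuity of translations in `L²`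
(`integral_leibniz_eq_zero`). Hence `[u | v] = H b - H a`, where `H` is the continuous
representative of `A u · v`.

Boundary values. Let `g` be a continuous function on `ℂ` equal to `t⁻¹` away from `0`. Then `H -
g(A) p · q = (A - A g(A) A) u · v`, and by spectral variation the matrix on the right has norm at
most `‖A(x) - A(x₀)‖ ≤ L |x - x₀|`. So this difference is continuous and bounded by `|x - x₀|` times
an integrable function; since `1 / |x - x₀|` is not integrable, it vanishes at `x₀`, and `H x₀ =
g(A(x₀)) p(x₀) · q(x₀)` (`IsFlux.boundary_value`). Near `x₀` the total projection is a continuous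
function of `A(x)` supported away from `0`, so one factor `A` can be split off and `P_l u` is a
continuous matrix function applied to `p`. Its value at `x₀` is `l⁻¹ E_l p(x₀)`, with `E_l` the
eigenprojection, and `H x₀` splits into the terms `l (P_l u) · (P_l v)`.

Closures. The closure of a graph is its double orthogonal complement, so `dom T₀` consists of the
`u` with `[u | v] = 0` for all `v` in the graph space. Testing with smooth `v` whose values at the
two end-points are prescribed independently makes all projected values of `u` vanish; the converse
is the boundary formula. The form is Hermitian, so `T̃₀` has the same domain. -/

namespace LinearPMap

/-! ### Domain of the closure of an operator on a Hilbert space -/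

/-- Double orthogonal complement description of the domain of the closure. -/
theorem mem_closure_domain_iff {E : Type*} [NormedAddCommGroup E] [InnerProductSpace ℂ E]
    [CompleteSpace E] {T : E →ₗ.[ℂ] E} (hT : Dense (T.domain : Set E)) (hc : T.IsClosable) (u : E) :
    u ∈ T.closure.domain ↔
      ∃ f, ∀ v : T.adjoint.domain, inner ℂ f (v : E) = inner ℂ u (T.adjoint v) := by
  have hg := hc.graph_closure_eq_closure_graph
  constructor
  · intro hu
    refine ⟨T.closure ⟨u, hu⟩, fun v => ?_⟩
    have hmem : (u, T.closure ⟨u, hu⟩) ∈ T.graph.topologicalClosure := by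
      rw [hg]; exact T.closure.mem_graph ⟨u, hu⟩
    have hcl : _root_.IsClosed {x : E × E | inner ℂ x.2 (v : E) = inner ℂ x.1 (T.adjoint v)} :=
      isClosed_eq (by fun_prop) (by fun_prop)
    have hsub : (T.graph : Set (E × E)) ⊆
        {x : E × E | inner ℂ x.2 (v : E) = inner ℂ x.1 (T.adjoint v)} := by
      rintro ⟨x, y⟩ hxy
      obtain ⟨z, rfl, rfl⟩ := (LinearPMap.mem_graph_iff _).1 hxy
      exact (adjoint_isFormalAdjoint hT).symm z v
    exact (closure_minimal hsub hcl) hmem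
  · rintro ⟨f, hf⟩
    -- The product `E × E` carries the sup norm; orthogonality needs its `L²` version.
    let e := WithLp.prodContinuousLinearEquiv 2 ℂ E E
    let G : Submodule ℂ (WithLp 2 (E × E)) := T.graph.comap (e : WithLp 2 (E × E) →ₗ[ℂ] E × E)
    have hx : e.symm (u, f) ∈ Gᗮᗮ := by
      rw [Submodule.mem_orthogonal]
      intro y hy
      -- Orthogonality of `y` to the graph says that `y.snd` lies in the domain of the adjoint, with
      -- image `-y.fst`; the assumption on `f` then makes `(u, f)` orthogonal to `y`.
      have h1 : ∀ x : T.domain, inner ℂ (-y.fst) (x : E) = inner ℂ y.snd (T x) := by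
        intro x
        have h2 : e.symm ((x : E), T x) ∈ G := by
          change e (e.symm ((x : E), T x)) ∈ T.graph
          rw [e.apply_symm_apply]
          exact T.mem_graph x
        have h3 := (Submodule.mem_orthogonal' _ _).1 hy _ h2
        rw [WithLp.prod_inner_apply] at h3
        rw [inner_neg_left, neg_eq_iff_add_eq_zero]
        exact h3
      have hd : y.snd ∈ T.adjoint.domain := mem_adjoint_domain_of_exists _ ⟨_, h1⟩
      have ha : T.adjoint ⟨y.snd, hd⟩ = -y.fst := adjoint_apply_eq hT _ h1
      have h4 := hf ⟨y.snd, hd⟩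
      rw [ha, inner_neg_right] at h4
      have h5 : inner ℂ (e.symm (u, f)) y = 0 := by
        rw [WithLp.prod_inner_apply]
        change inner ℂ u y.fst + inner ℂ f y.snd = 0
        rw [h4]; ring
      rw [← inner_conj_symm, h5]; exact RingHom.map_zero _
    rw [Submodule.orthogonal_orthogonal_eq_closure] at hx
    have hx' : e.symm (u, f) ∈ _root_.closure (e ⁻¹' (T.graph : Set (E × E))) := hx
    rw [show (e ⁻¹' (T.graph : Set (E × E))) = e.toHomeomorph ⁻¹' (T.graph : Set (E × E)) from rfl,
      ← e.toHomeomorph.preimage_closure] at hx'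
    have hx2 : (u, f) ∈ _root_.closure (T.graph : Set (E × E)) := by
      have h : e (e.symm (u, f)) ∈ _root_.closure (T.graph : Set (E × E)) := hx'
      rwa [e.apply_symm_apply] at h
    have hx3 : (u, f) ∈ T.closure.graph := by
      rw [← hg]; exact hx2
    obtain ⟨z, hz, -⟩ := (LinearPMap.mem_graph_iff _).1 hx3
    simp only at hz
    rw [← hz]; exact z.2

end LinearPMap

/-! ### Test functions and elementary rules for weak derivatives -/

theorem MeasureTheory.MemLp.integrable_inner_two {α E : Type*} [MeasurableSpace α] {μ : Measure α}
    [NormedAddCommGroup E] [InnerProductSpace ℂ E] {f g : α → E} (hf : MemLp f 2 μ)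
    (hg : MemLp g 2 μ) : Integrable (fun x => inner ℂ (f x) (g x)) μ := by
  refine (L2.integrable_inner (𝕜 := ℂ) (hf.toLp f) (hg.toLp g)).congr ?_
  filter_upwards [hf.coeFn_toLp, hg.coeFn_toLp] with x h1 h2
  rw [h1, h2]

namespace TestFunction

variable {a b : ℝ} {F : Type*} [NormedAddCommGroup F] [NormedSpace ℝ F]

/-- Composition of a test function with a continuous linear map. -/
def postLinear {G : Type*} [NormedAddCommGroup G] [NormedSpace ℝ G] (L : F →L[ℝ] G)
    (φ : 𝓓(openIoo a b, F)) : 𝓓(openIoo a b, G) where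
  toFun x := L (φ x)
  contDiff' := L.contDiff.comp φ.contDiff
  hasCompactSupport' := φ.hasCompactSupport.comp_left (map_zero L)
  tsupport_subset' := (tsupport_comp_subset (map_zero L) φ).trans φ.tsupport_subset

theorem hasDerivAt (φ : 𝓓(openIoo a b, F)) (x : ℝ) : HasDerivAt φ (deriv φ x) x :=
  (φ.contDiff.differentiable (by simp) x).hasDerivAt

theorem deriv_postLinear {G : Type*} [NormedAddCommGroup G] [NormedSpace ℝ G] (L : F →L[ℝ] G)
    (φ : 𝓓(openIoo a b, F)) (x : ℝ) : deriv (postLinear L φ) x = L (deriv φ x) :=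
  (L.hasFDerivAt.comp_hasDerivAt x (φ.hasDerivAt x)).deriv

/-- Product of a scalar test function with a smooth function. -/
def smulSmooth (φ : 𝓓(openIoo a b, ℝ)) (ζ : ℝ → F) (hζ : ContDiff ℝ (⊤ : ℕ∞) ζ) :
    𝓓(openIoo a b, F) where
  toFun x := φ x • ζ x
  contDiff' := φ.contDiff.smul hζ
  hasCompactSupport' := φ.hasCompactSupport.smul_right
  tsupport_subset' := (tsupport_smul_subset_left φ ζ).trans φ.tsupport_subset

theorem smulSmooth_apply (φ : 𝓓(openIoo a b, ℝ)) (ζ : ℝ → F) (hζ : ContDiff ℝ (⊤ : ℕ∞) ζ) (x : ℝ) :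
    smulSmooth φ ζ hζ x = φ x • ζ x := rfl

theorem deriv_smulSmooth (φ : 𝓓(openIoo a b, ℝ)) (ζ : ℝ → F) (hζ : ContDiff ℝ (⊤ : ℕ∞) ζ) (x : ℝ) :
    deriv (smulSmooth φ ζ hζ) x = φ x • deriv ζ x + deriv φ x • ζ x :=
  ((φ.hasDerivAt x).smul ((hζ.differentiable (by simp) x).hasDerivAt)).deriv

theorem continuous_deriv (φ : 𝓓(openIoo a b, F)) : Continuous (deriv φ) :=
  φ.contDiff.continuous_deriv (by simp)

theorem hasCompactSupport_deriv (φ : 𝓓(openIoo a b, F)) : HasCompactSupport (deriv φ) :=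
  φ.hasCompactSupport.deriv

theorem eq_zero_of_notMem (φ : 𝓓(openIoo a b, F)) {x : ℝ} (hx : x ∉ Ioo a b) : φ x = 0 :=
  image_eq_zero_of_notMem_tsupport fun h => hx (φ.tsupport_subset h)

theorem tsupport_deriv_subset (φ : 𝓓(openIoo a b, F)) : tsupport (deriv φ) ⊆ Ioo a b :=
  (_root_.tsupport_deriv_subset (𝕜 := ℝ)).trans φ.tsupport_subset

theorem deriv_eq_zero_of_notMem (φ : 𝓓(openIoo a b, F)) {x : ℝ} (hx : x ∉ Ioo a b) :
    deriv φ x = 0 :=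
  image_eq_zero_of_notMem_tsupport fun h => hx (φ.tsupport_deriv_subset h)

/-- The product of a continuous compactly supported scalar function supported in the open interval
with a locally integrable function is integrable. -/
theorem _root_.MeasureTheory.LocallyIntegrableOn.integrableOn_smul_of_tsupport {U : Set ℝ}
    {φ : ℝ → ℝ} {f : ℝ → F} (hf : LocallyIntegrableOn f U) (hφ : Continuous φ)
    (hc : HasCompactSupport φ) (hU : tsupport φ ⊆ U) :
    IntegrableOn (fun x => φ x • f x) U := by
  have h : IntegrableOn (fun x => φ x • f x) (tsupport φ) :=
    (hf.integrableOn_compact_subset hU hc).continuousOn_smul hφ.continuousOn hc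
  have h2 : Integrable (fun x => φ x • f x) := by
    rw [← integrableOn_iff_integrable_of_support_subset (s := tsupport φ)]
    · exact h
    · intro x hx
      exact subset_tsupport _ (left_ne_zero_of_smul hx)
  exact h2.integrableOn

theorem integrableOn_smul (φ : 𝓓(openIoo a b, ℝ)) {f : ℝ → F}
    (hf : LocallyIntegrableOn f (Ioo a b)) : IntegrableOn (fun x => φ x • f x) (Ioo a b) :=
  hf.integrableOn_smul_of_tsupport φ.continuous φ.hasCompactSupport φ.tsupport_subset

theorem integrableOn_deriv_smul (φ : 𝓓(openIoo a b, ℝ)) {f : ℝ → F}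
    (hf : LocallyIntegrableOn f (Ioo a b)) : IntegrableOn (fun x => deriv φ x • f x) (Ioo a b) :=
  hf.integrableOn_smul_of_tsupport φ.continuous_deriv φ.hasCompactSupport_deriv
    φ.tsupport_deriv_subset

end TestFunction

namespace IsWeakDeriv

variable {a b : ℝ} {F G : Type*} [NormedAddCommGroup F] [NormedSpace ℝ F]
  [NormedAddCommGroup G] [NormedSpace ℝ G]

theorem congr_ae {f g f' g' : ℝ → F} (h : IsWeakDeriv a b f g)
    (hf : f =ᵐ[intervalMeasure a b] f') (hg : g =ᵐ[intervalMeasure a b] g') :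
    IsWeakDeriv a b f' g' := by
  have key : ∀ {f f' : ℝ → F}, f =ᵐ[intervalMeasure a b] f' → LocallyIntegrableOn f (Ioo a b) →
      LocallyIntegrableOn f' (Ioo a b) := by
    intro f f' hff h x hx
    obtain ⟨t, ht, hi⟩ := h x hx
    refine ⟨t ∩ Ioo a b, Filter.inter_mem ht self_mem_nhdsWithin, ?_⟩
    have hi' : IntegrableOn f (t ∩ Ioo a b) := hi.mono_set inter_subset_left
    exact hi'.congr (ae_mono (Measure.restrict_mono inter_subset_right le_rfl) hff)
  refine ⟨key hf h.1, key hg h.2.1, fun φ => ?_⟩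
  have h1 : ∫ x in Ioo a b, deriv φ x • f' x = ∫ x in Ioo a b, deriv φ x • f x :=
    integral_congr_ae (hf.mono fun x hx => by simp only [hx])
  have h2 : ∫ x in Ioo a b, φ x • g' x = ∫ x in Ioo a b, φ x • g x :=
    integral_congr_ae (hg.mono fun x hx => by simp only [hx])
  rw [h1, h2, h.2.2 φ]

theorem add {f g f' g' : ℝ → F} (h : IsWeakDeriv a b f g) (h' : IsWeakDeriv a b f' g') :
    IsWeakDeriv a b (fun x => f x + f' x) (fun x => g x + g' x) := by
  refine ⟨h.1.add h'.1, h.2.1.add h'.2.1, fun φ => ?_⟩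
  simp only [smul_add]
  rw [integral_add (φ.integrableOn_deriv_smul h.1) (φ.integrableOn_deriv_smul h'.1),
    integral_add (φ.integrableOn_smul h.2.1) (φ.integrableOn_smul h'.2.1), h.2.2, h'.2.2]
  abel

theorem zero : IsWeakDeriv a b (fun _ => (0 : F)) (fun _ => 0) :=
  ⟨locallyIntegrableOn_zero, locallyIntegrableOn_zero, fun φ => by simp⟩

theorem sum {ι : Type*} (s : Finset ι) {f g : ι → ℝ → F}
    (h : ∀ i ∈ s, IsWeakDeriv a b (f i) (g i)) :
    IsWeakDeriv a b (fun x => ∑ i ∈ s, f i x) (fun x => ∑ i ∈ s, g i x) := by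
  classical
  induction s using Finset.induction_on with
  | empty => simpa using zero
  | insert i s hi ih =>
    simp only [Finset.sum_insert hi]
    exact (h i (Finset.mem_insert_self i s)).add
      (ih fun j hj => h j (Finset.mem_insert_of_mem hj))

theorem _root_.MeasureTheory.LocallyIntegrableOn.clm_comp {s : Set ℝ} {f : ℝ → F}
    (h : LocallyIntegrableOn f s) (L : F →L[ℝ] G) : LocallyIntegrableOn (fun x => L (f x)) s := by
  intro x hx
  obtain ⟨t, ht, hi⟩ := h x hx
  exact ⟨t, ht, L.integrable_comp hi⟩

theorem clm_comp [CompleteSpace F] [CompleteSpace G] {f g : ℝ → F} (h : IsWeakDeriv a b f g)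
    (L : F →L[ℝ] G) : IsWeakDeriv a b (fun x => L (f x)) (fun x => L (g x)) := by
  refine ⟨h.1.clm_comp L, h.2.1.clm_comp L, fun φ => ?_⟩
  simp only [← map_smul]
  rw [L.integral_comp_comm (φ.integrableOn_deriv_smul h.1),
    L.integral_comp_comm (φ.integrableOn_smul h.2.1), h.2.2, map_neg]

/-- Product rule for a weakly differentiable scalar function and a smooth function. -/
theorem smul_smooth {f g : ℝ → ℂ} (h : IsWeakDeriv a b f g) {ζ : ℝ → ℂ}
    (hζ : ContDiff ℝ (⊤ : ℕ∞) ζ) :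
    IsWeakDeriv a b (fun x => f x * ζ x) (fun x => f x * deriv ζ x + g x * ζ x) := by
  have hc : ∀ {f : ℝ → ℂ} {ζ : ℝ → ℂ}, LocallyIntegrableOn f (Ioo a b) → Continuous ζ →
      LocallyIntegrableOn (fun x => f x * ζ x) (Ioo a b) := fun hf hz =>
    hf.mul_continuousOn hz.continuousOn isOpen_Ioo.isLocallyClosed
  -- For real `ξ` the product `φ ξ` is again a real test function, so the rule can be read off from
  -- the definition; the complex case combines real and imaginary parts.
  have hreal : ∀ {ξ : ℝ → ℝ}, ContDiff ℝ (⊤ : ℕ∞) ξ →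
      IsWeakDeriv a b (fun x => f x * ξ x) (fun x => f x * (deriv ξ x : ℝ) + g x * ξ x) := by
    intro ξ hξ
    have c1 : Continuous fun x => (ξ x : ℂ) := Complex.continuous_ofReal.comp hξ.continuous
    have c2 : Continuous fun x => ((deriv ξ x : ℝ) : ℂ) :=
      Complex.continuous_ofReal.comp (hξ.continuous_deriv (by simp))
    refine ⟨hc h.1 c1, (hc h.1 c2).add (hc h.2.1 c1), fun φ => ?_⟩
    have h1 := h.2.2 (φ.smulSmooth ξ hξ)
    simp only [TestFunction.deriv_smulSmooth, TestFunction.smulSmooth_apply] at h1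
    have e1 : ∀ x, (φ x • deriv ξ x + deriv φ x • ξ x) • f x
        = φ x • (f x * (deriv ξ x : ℝ)) + deriv φ x • (f x * ξ x) := by
      intro x
      simp only [Complex.real_smul, smul_eq_mul]
      push_cast
      ring
    have e2 : ∀ x, φ x • (f x * (deriv ξ x : ℝ) + g x * ξ x)
        = φ x • (f x * (deriv ξ x : ℝ)) + φ x • (g x * ξ x) := fun x => smul_add _ _ _
    have e3 : ∀ x, (φ x • ξ x) • g x = φ x • (g x * ξ x) := by
      intro x
      simp only [Complex.real_smul, smul_eq_mul]
      push_cast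
      ring
    simp only [e1, e3] at h1
    simp only [e2]
    rw [integral_add (φ.integrableOn_smul (hc h.1 c2)) (φ.integrableOn_deriv_smul (hc h.1 c1))]
      at h1
    rw [integral_add (φ.integrableOn_smul (hc h.1 c2)) (φ.integrableOn_smul (hc h.2.1 c1))]
    linear_combination h1
  have hre : ContDiff ℝ (⊤ : ℕ∞) fun x => (ζ x).re := Complex.reCLM.contDiff.comp hζ
  have him : ContDiff ℝ (⊤ : ℕ∞) fun x => (ζ x).im := Complex.imCLM.contDiff.comp hζ
  have h1 := hreal hre
  have h2 := (hreal him).clm_comp (Complex.I • ContinuousLinearMap.id ℝ ℂ)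
  have hd : ∀ x, deriv ζ x
      = (deriv (fun x => (ζ x).re) x : ℝ) + Complex.I * (deriv (fun x => (ζ x).im) x : ℝ) := by
    intro x
    have hz := (hζ.differentiable (by simp) x).hasDerivAt
    have d1 : deriv (fun x => (ζ x).re) x = (deriv ζ x).re :=
      (Complex.reCLM.hasFDerivAt.comp_hasDerivAt x hz).deriv
    have d2 : deriv (fun x => (ζ x).im) x = (deriv ζ x).im :=
      (Complex.imCLM.hasFDerivAt.comp_hasDerivAt x hz).deriv
    rw [d1, d2, mul_comm, Complex.re_add_im]
  refine (h1.add h2).congr_ae (Filter.Eventually.of_forall fun x => ?_)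
    (Filter.Eventually.of_forall fun x => ?_)
  · simp only [_root_.smul_apply, ContinuousLinearMap.id_apply, smul_eq_mul]
    conv_rhs => rw [← Complex.re_add_im (ζ x)]
    ring
  · simp only [_root_.smul_apply, ContinuousLinearMap.id_apply, smul_eq_mul]
    rw [hd x]
    conv_rhs => rw [← Complex.re_add_im (ζ x)]
    ring

end IsWeakDeriv

instance {a b : ℝ} : IsFiniteMeasure (intervalMeasure a b) :=
  ⟨by rw [Measure.restrict_apply_univ]; exact measure_Ioo_lt_top⟩

theorem MeasureTheory.MemLp.integrableOn_Ioo {a b : ℝ} {F : Type*} [NormedAddCommGroup F]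
    {f : ℝ → F} {p : ℝ≥0∞} (hp : 1 ≤ p) (hf : MemLp f p (intervalMeasure a b)) :
    IntegrableOn f (Ioo a b) :=
  hf.integrable hp

/-- Weak differentiability tested with vector-valued test functions. -/
theorem isWeakDeriv_iff_inner {a b : ℝ} {r : ℕ} {f g : ℝ → Cvec r}
    (hf : MemLp f 2 (intervalMeasure a b)) (hg : MemLp g 2 (intervalMeasure a b)) :
    IsWeakDeriv a b f g ↔ ∀ φ : 𝓓(openIoo a b, Cvec r),
      ∫ x in Ioo a b, inner ℂ (f x) (deriv φ x) = - ∫ x in Ioo a b, inner ℂ (g x) (φ x) := by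
  have hfl : LocallyIntegrableOn f (Ioo a b) :=
    (hf.integrableOn_Ioo (by norm_num)).locallyIntegrableOn
  have hgl : LocallyIntegrableOn g (Ioo a b) :=
    (hg.integrableOn_Ioo (by norm_num)).locallyIntegrableOn
  have key : ∀ {f : ℝ → Cvec r} {ψ : ℝ → ℝ}, IntegrableOn (fun x => ψ x • f x) (Ioo a b) →
      ∀ c : Cvec r, ∫ x in Ioo a b, inner ℂ (f x) (ψ x • c)
        = inner ℂ (∫ x in Ioo a b, ψ x • f x) c := by
    intro f ψ hi c
    have e : ∀ x, inner ℂ (f x) (ψ x • c) = starRingEnd ℂ (inner ℂ c (ψ x • f x)) := by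
      intro x
      rw [inner_conj_symm, inner_smul_right_eq_smul, inner_smul_left_eq_smul]
    simp only [e]
    rw [integral_conj, integral_inner hi, inner_conj_symm]
  constructor
  · intro h φ
    -- A basis over `ℝ`, so that the coordinates of a vector-valued test function are real test
    -- functions.
    let bs := Module.finBasis ℝ (Cvec r)
    let ψ : Fin (Module.finrank ℝ (Cvec r)) → 𝓓(openIoo a b, ℝ) := fun i =>
      φ.postLinear (LinearMap.toContinuousLinearMap (bs.coord i))
    have e1 : ∀ x, φ x = ∑ i, ψ i x • bs i := fun x => (bs.sum_repr (φ x)).symm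
    have e2 : ∀ x, deriv φ x = ∑ i, deriv (ψ i) x • bs i := by
      intro x
      rw [← bs.sum_repr (deriv φ x)]
      refine Finset.sum_congr rfl fun i _ => ?_
      rw [TestFunction.deriv_postLinear]
      rfl
    have hi : ∀ {f : ℝ → Cvec r} {ψ : ℝ → ℝ}, IntegrableOn (fun x => ψ x • f x) (Ioo a b) →
        ∀ c : Cvec r, IntegrableOn (fun x => inner ℂ (f x) (ψ x • c)) (Ioo a b) := by
      intro f ψ hi c
      refine (Integrable.inner_const hi c).congr (Filter.Eventually.of_forall fun x => ?_)
      simp only [inner_smul_right_eq_smul, inner_smul_left_eq_smul]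
    simp only [e1, e2, inner_sum]
    rw [integral_finsetSum _ fun i _ => hi ((ψ i).integrableOn_deriv_smul hfl) (bs i),
      integral_finsetSum _ fun i _ => hi ((ψ i).integrableOn_smul hgl) (bs i),
      ← Finset.sum_neg_distrib]
    refine Finset.sum_congr rfl fun i _ => ?_
    rw [key ((ψ i).integrableOn_deriv_smul hfl), key ((ψ i).integrableOn_smul hgl), h.2.2,
      inner_neg_left]
  · intro h
    refine ⟨hfl, hgl, fun φ => ?_⟩
    refine ext_inner_right ℂ fun c => ?_
    rw [inner_neg_left, ← key (φ.integrableOn_deriv_smul hfl) c, ← key (φ.integrableOn_smul hgl) c]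
    have h1 := h (φ.smulSmooth (fun _ => c) contDiff_const)
    simpa only [TestFunction.deriv_smulSmooth, TestFunction.smulSmooth_apply, deriv_const,
      smul_zero, zero_add] using h1

/-- An `f` orthogonal to all test functions `φ c`, with scalar `φ` and a constant vector `c`, has `∫
φ f = 0` for every `φ`, hence vanishes almost everywhere. -/
theorem dense_range_testToL2 (a b : ℝ) (r : ℕ) :
    Dense (LinearMap.range (testToL2 a b r) : Set (L2Space a b r)) := by
  rw [Submodule.dense_iff_topologicalClosure_eq_top, Submodule.topologicalClosure_eq_top_iff,
    Submodule.eq_bot_iff]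
  intro f hf
  have hfm := Lp.memLp f
  have hz : ∀ᵐ x ∂volume, x ∈ Ioo a b → f x = 0 := by
    refine isOpen_Ioo.ae_eq_zero_of_integral_contDiff_smul_eq_zero
      (hfm.integrableOn_Ioo (by norm_num)).locallyIntegrableOn fun φ h1 h2 h3 => ?_
    let ψ : 𝓓(openIoo a b, ℝ) := ⟨φ, h1, h2, h3⟩
    have hi : IntegrableOn (fun x => φ x • f x) (Ioo a b) :=
      ψ.integrableOn_smul (hfm.integrableOn_Ioo (by norm_num)).locallyIntegrableOn
    have hs : ∫ x, φ x • f x = ∫ x in Ioo a b, φ x • f x := by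
      rw [setIntegral_eq_integral_of_forall_compl_eq_zero]
      intro x hx
      rw [show φ x = 0 from ψ.eq_zero_of_notMem hx, zero_smul]
    rw [hs]
    refine ext_inner_left ℂ fun c => ?_
    rw [← integral_inner hi, inner_zero_right]
    have h4 := (Submodule.mem_orthogonal _ _).1 hf _
      (LinearMap.mem_range_self (testToL2 a b r) (ψ.smulSmooth (fun _ => c) contDiff_const))
    rw [L2.inner_def] at h4
    rw [← h4]
    refine integral_congr_ae ?_
    filter_upwards [(memLp_testFunction (ψ.smulSmooth (fun _ => c) contDiff_const)).coeFn_toLp]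
      with x hx
    change _ = inner ℂ (((memLp_testFunction (ψ.smulSmooth (fun _ => c) contDiff_const)).toLp
      _ : L2Space a b r) x) (f x)
    rw [hx, TestFunction.smulSmooth_apply, inner_smul_left_eq_smul, inner_smul_right_eq_smul]
    rfl
  rw [Lp.eq_zero_iff_ae_eq_zero]
  exact (ae_restrict_iff' measurableSet_Ioo).2 hz

/-! ### The lemma of du Bois-Reymond and primitives -/

namespace TestFunction

variable {a b : ℝ} {F : Type*} [NormedAddCommGroup F] [NormedSpace ℝ F]

theorem exists_Icc (hab : a < b) (φ : 𝓓(openIoo a b, F)) :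
    ∃ c d, a < c ∧ c ≤ d ∧ d < b ∧ ∀ x, x ∉ Icc c d → φ x = 0 := by
  have hm : (a + b) / 2 ∈ Ioo a b := ⟨by linarith, by linarith⟩
  -- The midpoint is adjoined so that the compact set is nonempty also for `φ = 0`.
  have hK : IsCompact (insert ((a + b) / 2) (tsupport φ)) :=
    IsCompact.insert φ.hasCompactSupport _
  have hsub : insert ((a + b) / 2) (tsupport φ) ⊆ Ioo a b :=
    insert_subset hm φ.tsupport_subset
  obtain ⟨c, hc⟩ := hK.exists_isLeast (insert_nonempty _ _)
  obtain ⟨d, hd⟩ := hK.exists_isGreatest (insert_nonempty _ _)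
  refine ⟨c, d, (hsub hc.1).1, hc.2 hd.1, (hsub hd.1).2, fun x hx => ?_⟩
  refine image_eq_zero_of_notMem_tsupport fun h => hx ?_
  exact ⟨hc.2 (mem_insert_of_mem _ h), hd.2 (mem_insert_of_mem _ h)⟩

/-- A test function with vanishing integral is the derivative of a test function. -/
theorem exists_antideriv (hab : a < b) (ψ : 𝓓(openIoo a b, ℝ)) (h0 : ∫ x, ψ x = 0) :
    ∃ Ψ : 𝓓(openIoo a b, ℝ), deriv Ψ = ψ := by
  obtain ⟨c, d, hac, hcd, hdb, hz⟩ := ψ.exists_Icc hab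
  have hder : ∀ x, HasDerivAt (fun x => ∫ t in a..x, ψ t) (ψ x) x := fun x =>
    intervalIntegral.integral_hasDerivAt_right (ψ.continuous.intervalIntegrable _ _)
      (ψ.continuous.stronglyMeasurableAtFilter _ _) ψ.continuous.continuousAt
  have hdf : deriv (fun x => ∫ t in a..x, ψ t) = ψ := funext fun x => (hder x).deriv
  have hsm : ContDiff ℝ (⊤ : ℕ∞) (fun x => ∫ t in a..x, ψ t) :=
    contDiff_infty_iff_deriv.2 ⟨fun x => (hder x).differentiableAt, by rw [hdf]; exact ψ.contDiff⟩
  -- To the left of the support the primitive is trivially zero; to the right it is the full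
  -- integral of `ψ`, zero by assumption.
  have hout : ∀ x, x ∉ Icc c d → (∫ t in a..x, ψ t) = 0 := by
    intro x hx
    rcases lt_or_ge x c with h | h
    · rw [intervalIntegral.integral_congr (g := fun _ => 0), intervalIntegral.integral_zero]
      intro t ht
      refine hz t fun h' => ?_
      rcases le_total a x with h1 | h1
      · rw [uIcc_of_le h1] at ht; linarith [ht.2, h'.1]
      · rw [uIcc_of_ge h1] at ht; linarith [ht.2, h'.1]
    · have hdx : d < x := by
        by_contra h'; exact hx ⟨h, not_lt.1 h'⟩
      rw [intervalIntegral.integral_eq_integral_of_support_subset, h0]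
      intro t ht
      have : t ∈ Icc c d := by
        by_contra h'; exact ht (hz t h')
      exact ⟨by linarith [this.1], by linarith [this.2]⟩
  have hts : tsupport (fun x => ∫ t in a..x, ψ t) ⊆ Icc c d := by
    refine closure_minimal (fun x hx => ?_) isClosed_Icc
    by_contra h; exact hx (hout x h)
  exact ⟨⟨_, hsm, isCompact_Icc.of_isClosed_subset (isClosed_tsupport _) hts,
    hts.trans fun x hx => ⟨hac.trans_le hx.1, hx.2.trans_lt hdb⟩⟩, hdf⟩

theorem exists_integral_eq_one (hab : a < b) : ∃ η : 𝓓(openIoo a b, ℝ), ∫ x, η x = 1 := by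
  let f : ContDiffBump ((a + b) / 2) := ⟨(b - a) / 8, (b - a) / 4, by linarith, by linarith⟩
  refine ⟨⟨f.normed volume, f.contDiff_normed, f.hasCompactSupport_normed, ?_⟩, f.integral_normed⟩
  rw [f.tsupport_normed_eq, Real.closedBall_eq_Icc]
  intro x hx
  have h1 := hx.1
  have h2 := hx.2
  change _ - (b - a) / 4 ≤ _ at h1
  change _ ≤ _ + (b - a) / 4 at h2
  exact ⟨by linarith, by linarith⟩

theorem integral_eq_setIntegral {φ : ℝ → ℝ} (hφ : ∀ x, x ∉ Ioo a b → φ x = 0) (f : ℝ → F) :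
    ∫ x in Ioo a b, φ x • f x = ∫ x, φ x • f x :=
  setIntegral_eq_integral_of_forall_compl_eq_zero fun x hx => by rw [hφ x hx, zero_smul]

end TestFunction

namespace IsWeakDeriv

variable {a b : ℝ} {F : Type*} [NormedAddCommGroup F] [NormedSpace ℝ F] [CompleteSpace F]

/-- The lemma of du Bois-Reymond: a function with vanishing weak derivative is constant. -/
theorem exists_ae_eq_const (hab : a < b) {f : ℝ → F} (h : IsWeakDeriv a b f fun _ => 0) :
    ∃ c : F, ∀ᵐ x ∂(intervalMeasure a b), f x = c := by
  obtain ⟨η, hη⟩ := TestFunction.exists_integral_eq_one hab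
  refine ⟨∫ x in Ioo a b, η x • f x, ?_⟩
  set c := ∫ x in Ioo a b, η x • f x with hc
  rw [ae_restrict_iff' measurableSet_Ioo]
  have hconst : LocallyIntegrableOn (fun _ : ℝ => c) (Ioo a b) :=
    (integrableOn_const (by simp)).locallyIntegrableOn
  have key : ∀ᵐ x ∂volume, x ∈ Ioo a b → f x - c = 0 := by
    refine isOpen_Ioo.ae_eq_zero_of_integral_contDiff_smul_eq_zero (h.1.sub hconst)
      fun φ h1 h2 h3 => ?_
    let χ : 𝓓(openIoo a b, ℝ) := ⟨φ, h1, h2, h3⟩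
    change ∫ x, χ x • (f x - c) = 0
    let I : ℝ := ∫ x, χ x
    -- Subtracting `I • η` makes the mean zero, so the result is the derivative of a test function
    -- and integrates to zero against `f`.
    have hψ : ∫ x, (χ - I • η) x = 0 := by
      change ∫ x, (χ x - I * η x) = 0
      rw [integral_sub (χ.continuous.integrable_of_hasCompactSupport χ.hasCompactSupport)
        ((η.continuous.integrable_of_hasCompactSupport η.hasCompactSupport).const_mul _),
        integral_const_mul, hη, mul_one, sub_self]
    obtain ⟨Ψ, hΨ⟩ := (χ - I • η).exists_antideriv hab hψ
    have h4 := h.2.2 Ψ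
    rw [hΨ] at h4
    simp only [smul_zero, integral_zero, neg_zero] at h4
    have h5 : ∀ x, (χ - I • η) x • f x = χ x • f x - I • (η x • f x) := by
      intro x
      rw [← smul_assoc, ← sub_smul]; rfl
    simp only [h5] at h4
    rw [integral_sub (χ.integrableOn_smul h.1) ((η.integrableOn_smul h.1).fun_smul I),
      integral_smul, ← hc] at h4
    rw [← TestFunction.integral_eq_setIntegral (a := a) (b := b) fun x => χ.eq_zero_of_notMem]
    simp only [smul_sub]
    rw [integral_sub (χ.integrableOn_smul h.1) (χ.integrableOn_smul hconst), integral_smul_const,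
      setIntegral_eq_integral_of_forall_compl_eq_zero fun x hx => χ.eq_zero_of_notMem hx]
    exact h4
  filter_upwards [key] with x hx hx'
  exact sub_eq_zero.1 (hx hx')

/-- The primitive of an integrable function is weakly differentiable. -/
theorem primitive {g : ℝ → F} (hg : IntegrableOn g (Ioo a b)) :
    IsWeakDeriv a b (fun x => ∫ t in a..x, g t) g := by
  rcases lt_or_ge a b with hab | hab
  swap
  · rw [IsWeakDeriv, Ioo_eq_empty (not_lt.2 hab)]
    exact ⟨fun x hx => hx.elim, fun x hx => hx.elim, fun φ => by simp⟩
  have hgi : IntegrableOn g (Icc a b) := (integrableOn_Icc_iff_integrableOn_Ioo (by simp) (by simp)).2 hg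
  have hcont : ContinuousOn (fun x => ∫ t in a..x, g t) (Icc a b) := by
    rw [← uIcc_of_le hab.le] at hgi ⊢
    exact intervalIntegral.continuousOn_primitive_interval hgi
  refine ⟨(hcont.integrableOn_Icc.mono_set Ioo_subset_Icc_self).locallyIntegrableOn,
    hg.locallyIntegrableOn, fun φ => ?_⟩
  -- The left side is a double integral over `t < x`. After Fubini the inner integral is that of
  -- `φ'` over `(t, ∞)`, which equals `-φ t`.
  have e1 : ∀ x ∈ Ioo a b, deriv φ x • ∫ t in a..x, g t
      = ∫ t in Ioo a b, (Iio x).indicator (fun t => deriv φ x • g t) t := by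
    intro x hx
    rw [setIntegral_indicator measurableSet_Iio, intervalIntegral.integral_of_le hx.1.le,
      integral_smul, integral_Ioc_eq_integral_Ioo]
    congr 2
    congr 1
    ext t
    simp only [mem_Ioo, mem_inter_iff, mem_Iio]
    constructor
    · rintro ⟨h1, h2⟩; exact ⟨⟨h1, h2.trans hx.2⟩, h2⟩
    · rintro ⟨⟨h1, -⟩, h2⟩; exact ⟨h1, h2⟩
  rw [setIntegral_congr_fun measurableSet_Ioo e1]
  have hint : Integrable (fun z : ℝ × ℝ => {z : ℝ × ℝ | z.2 < z.1}.indicator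
      (fun z => deriv φ z.1 • g z.2) z) ((intervalMeasure a b).prod (intervalMeasure a b)) := by
    refine Integrable.indicator ?_ (measurableSet_lt measurable_snd measurable_fst)
    exact Integrable.smul_prod ((φ.continuous_deriv.integrable_of_hasCompactSupport
      φ.hasCompactSupport_deriv).restrict) hg
  have hsw := integral_integral_swap (μ := intervalMeasure a b) (ν := intervalMeasure a b)
    (f := fun x t => (Iio x).indicator (fun t => deriv φ x • g t) t) hint
  rw [hsw, ← integral_neg]
  refine setIntegral_congr_fun measurableSet_Ioo fun t ht => ?_
  have e2 : ∀ x, (Iio x).indicator (fun t => deriv φ x • g t) t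
      = ((Ioi t).indicator (deriv φ) x) • g t := by
    intro x
    by_cases hx : t < x
    · rw [indicator_of_mem (mem_Iio.2 hx), indicator_of_mem (mem_Ioi.2 hx)]
    · rw [indicator_of_notMem (by simpa using hx), indicator_of_notMem (by simpa using hx),
        zero_smul]
  simp only [e2]
  rw [integral_smul_const, setIntegral_eq_integral_of_forall_compl_eq_zero (fun x hx => by
      simp only [indicator, φ.deriv_eq_zero_of_notMem hx, ite_self]),
    integral_indicator measurableSet_Ioi,
    φ.hasCompactSupport.integral_Ioi_deriv_eq (φ.contDiff.of_le (by simp)), neg_smul]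

theorem neg {f g : ℝ → F} (h : IsWeakDeriv a b f g) :
    IsWeakDeriv a b (fun x => -f x) (fun x => -g x) :=
  h.clm_comp (-ContinuousLinearMap.id ℝ F)

/-- Subtracting the primitive of `g` leaves a function with weak derivative zero, which is constant.
-/
theorem exists_ae_eq_primitive (hab : a < b) {f g : ℝ → F} (h : IsWeakDeriv a b f g)
    (hg : IntegrableOn g (Ioo a b)) :
    ∃ c : F, ∀ᵐ x ∂(intervalMeasure a b), f x = c + ∫ t in a..x, g t := by
  have h1 := h.add (primitive hg).neg
  simp only [add_neg_cancel] at h1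
  obtain ⟨c, hc⟩ := h1.exists_ae_eq_const hab
  exact ⟨c, hc.mono fun x hx => by rw [← hx]; abel⟩

theorem ae_unique {f g g' : ℝ → F} (h : IsWeakDeriv a b f g) (h' : IsWeakDeriv a b f g') :
    g =ᵐ[intervalMeasure a b] g' := by
  have h0 := h.add h'.neg
  simp only [add_neg_cancel] at h0
  have key : ∀ᵐ x ∂volume, x ∈ Ioo a b → g x + -g' x = 0 := by
    refine isOpen_Ioo.ae_eq_zero_of_integral_contDiff_smul_eq_zero h0.2.1 fun φ h1 h2 h3 => ?_
    let χ : 𝓓(openIoo a b, ℝ) := ⟨φ, h1, h2, h3⟩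
    have h4 := h0.2.2 χ
    simp only [smul_zero, integral_zero] at h4
    change ∫ x, χ x • (g x + -g' x) = 0
    rw [← TestFunction.integral_eq_setIntegral (a := a) (b := b) fun x => χ.eq_zero_of_notMem]
    exact neg_eq_zero.1 h4.symm
  refine (ae_restrict_iff' measurableSet_Ioo).2 (key.mono fun x hx hx' => ?_)
  have := hx hx'
  rwa [← sub_eq_add_neg, sub_eq_zero] at this

end IsWeakDeriv

theorem continuousOn_const_add_primitive {a b : ℝ} (hab : a < b) {F : Type*}
    [NormedAddCommGroup F] [NormedSpace ℝ F] {g : ℝ → F} (hg : IntegrableOn g (Ioo a b)) (c : F) :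
    ContinuousOn (fun x => c + ∫ t in a..x, g t) (Icc a b) := by
  have hgi : IntegrableOn g (Icc a b) := (integrableOn_Icc_iff_integrableOn_Ioo (by simp) (by simp)).2 hg
  rw [← uIcc_of_le hab.le] at hgi ⊢
  exact continuousOn_const.add (intervalIntegral.continuousOn_primitive_interval hgi)

theorem eqOn_Icc_of_ae_eq {a b : ℝ} (hab : a < b) {F : Type*} [TopologicalSpace F] [T2Space F]
    {f g : ℝ → F} (hf : ContinuousOn f (Icc a b)) (hg : ContinuousOn g (Icc a b))
    (h : ∀ᵐ x ∂(intervalMeasure a b), f x = g x) : EqOn f g (Icc a b) := by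
  have h1 : EqOn f g (Ioo a b) := Measure.eqOn_open_of_ae_eq h isOpen_Ioo
    (hf.mono Ioo_subset_Icc_self) (hg.mono Ioo_subset_Icc_self)
  exact h1.of_subset_closure hf hg Ioo_subset_Icc_self (closure_Ioo hab.ne).superset

/-! ### Translations in `L²` and limits of difference quotients -/

theorem MeasureTheory.MemLp.comp_add_right {E : Type*} [NormedAddCommGroup E] {p : ℝ≥0∞}
    {f : ℝ → E} (hf : MemLp f p volume) (s : ℝ) : MemLp (fun x => f (x + s)) p volume :=
  hf.comp_measurePreserving (measurePreserving_add_right volume s)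

/-- Translation is strongly continuous on `L²(ℝ)`. -/
theorem continuous_toLp_translate {f : ℝ → ℂ} (hf : MemLp f 2 volume) :
    Continuous fun s : ℝ => (hf.comp_add_right s).toLp (fun x => f (x + s)) := by
  have hg : Continuous fun s : ℝ => (⟨fun x => x + s, by fun_prop⟩ : C(ℝ, ℝ)) := by
    refine ContinuousMap.continuous_of_continuous_uncurry _ ?_
    change Continuous fun z : ℝ × ℝ => z.2 + z.1
    fun_prop
  exact (continuous_const (y := hf.toLp f)).compMeasurePreservingLp hg
    (fun s => measurePreserving_add_right volume s) (by simp)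

/-- Multiplication by `m` followed by the integral pairing is a continuous bilinear form on `L²`,
and translations are strongly continuous there. -/
theorem continuous_integral_translate {m f g : ℝ → ℂ} (hm : MemLp m ∞ volume)
    (hf : MemLp f 2 volume) (hg : MemLp g 2 volume) :
    Continuous fun z : ℝ × ℝ => ∫ x, m x * (f (x + z.1) * g (x + z.2)) := by
  let B := ContinuousLinearMap.mul ℂ ℂ
  have h1 : Continuous fun z : ℝ × ℝ => B.lpPairing volume 2 2
      (B.holderL volume ∞ 2 2 (hm.toLp m) ((hf.comp_add_right z.1).toLp (fun x => f (x + z.1))))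
      ((hg.comp_add_right z.2).toLp (fun x => g (x + z.2))) := by
    have c1 := (continuous_toLp_translate hf).comp (continuous_fst (X := ℝ) (Y := ℝ))
    have c2 := (continuous_toLp_translate hg).comp (continuous_snd (X := ℝ) (Y := ℝ))
    exact ((B.lpPairing volume 2 2).continuous.comp
      ((B.holderL volume ∞ 2 2 (hm.toLp m)).continuous.comp c1)).clm_apply c2
  refine h1.congr fun z => ?_
  rw [ContinuousLinearMap.lpPairing_eq_integral]
  refine integral_congr_ae ?_
  filter_upwards [B.coeFn_holder (r := 2) (hm.toLp m)
    ((hf.comp_add_right z.1).toLp (fun x => f (x + z.1))), hm.coeFn_toLp,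
    (hf.comp_add_right z.1).coeFn_toLp, (hg.comp_add_right z.2).coeFn_toLp] with x e1 e2 e3 e4
  have e1' : (B.holderL volume ∞ 2 2 (hm.toLp m)
    ((hf.comp_add_right z.1).toLp (fun x => f (x + z.1)))) x = m x * f (x + z.1) := by
    rw [← e2, ← e3]; exact e1
  rw [e1', e4]
  change m x * f (x + z.1) * g (x + z.2) = _
  ring

/-- Averages over shrinking intervals of a function that is continuous at the corner. -/
theorem tendsto_average_of_tendsto {K : ℝ → ℝ → ℂ} {L : ℂ}
    (hK : Tendsto (fun z : ℝ × ℝ => K z.1 z.2) (𝓝 (0, 0)) (𝓝 L))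
    (hi : ∀ ε, 0 < ε → IntervalIntegrable (K ε) volume 0 ε) :
    Tendsto (fun ε : ℝ => (ε : ℂ)⁻¹ * ∫ s in 0..ε, K ε s) (𝓝[>] 0) (𝓝 L) := by
  rw [Metric.tendsto_nhds]
  intro δ hδ
  obtain ⟨η, hη, h⟩ := Metric.eventually_nhds_iff.1 ((Metric.tendsto_nhds.1 hK) (δ / 2) (by linarith))
  filter_upwards [Ioo_mem_nhdsGT hη] with ε hε
  have hε0 : (ε : ℂ) ≠ 0 := by exact_mod_cast hε.1.ne'
  have e1 : (ε : ℂ)⁻¹ * (∫ s in 0..ε, K ε s) - L = (ε : ℂ)⁻¹ * ∫ s in 0..ε, (K ε s - L) := by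
    rw [intervalIntegral.integral_sub (hi ε hε.1) intervalIntegrable_const,
      intervalIntegral.integral_const, mul_sub, sub_zero, Complex.real_smul, inv_mul_cancel_left₀ hε0]
  have e2 : ‖∫ s in 0..ε, (K ε s - L)‖ ≤ δ / 2 * |ε - 0| := by
    refine intervalIntegral.norm_integral_le_of_norm_le_const fun s hs => ?_
    rw [uIoc_of_le hε.1.le] at hs
    have hz : dist ((ε, s) : ℝ × ℝ) (0, 0) < η := by
      rw [Prod.dist_eq, max_lt_iff, Real.dist_eq, Real.dist_eq]
      simp only [sub_zero]
      exact ⟨by rw [abs_of_pos hε.1]; exact hε.2, by rw [abs_of_pos hs.1]; linarith [hs.2, hε.2]⟩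
    have := h hz
    rw [dist_eq_norm] at this
    exact this.le
  rw [dist_eq_norm, e1, norm_mul, norm_inv, Complex.norm_real, Real.norm_of_nonneg hε.1.le]
  rw [sub_zero, abs_of_pos hε.1] at e2
  calc ε⁻¹ * ‖∫ s in 0..ε, (K ε s - L)‖ ≤ ε⁻¹ * (δ / 2 * ε) := by
        have := hε.1; gcongr
    _ = δ / 2 := by have := hε.1.ne'; field_simp
    _ < δ := by linarith

/-- Fubini's theorem for averages of translates. -/
theorem fubini_translate {α β : ℝ → ℂ} (hα : StronglyMeasurable α) (hβ : StronglyMeasurable β)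
    {C : ℝ} (hi : ∀ s, Integrable fun x => α (x + s) * β x)
    (hC : ∀ s, ∫ x, ‖α (x + s) * β x‖ ≤ C) {ε : ℝ} (hε : 0 ≤ ε) :
    Integrable (fun x => (∫ s in 0..ε, α (x + s)) * β x) ∧
    IntervalIntegrable (fun s => ∫ x, α (x + s) * β x) volume 0 ε ∧
    ∫ x, (∫ s in 0..ε, α (x + s)) * β x = ∫ s in 0..ε, ∫ x, α (x + s) * β x := by
  have hmeas : StronglyMeasurable fun z : ℝ × ℝ => α (z.1 + z.2) * β z.1 :=
    (hα.comp_measurable (measurable_fst.add measurable_snd)).mul (hβ.comp_measurable measurable_fst)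
  have hprod : Integrable (fun z : ℝ × ℝ => α (z.1 + z.2) * β z.1)
      (volume.prod (volume.restrict (Ioc 0 ε))) := by
    rw [integrable_prod_iff' hmeas.aestronglyMeasurable]
    refine ⟨Eventually.of_forall fun s => hi s, ?_⟩
    refine Integrable.of_bound (C := C) ?_ (Eventually.of_forall fun s => ?_)
    · exact hmeas.norm.integral_prod_left'.aestronglyMeasurable
    · rw [Real.norm_of_nonneg (integral_nonneg fun x => norm_nonneg _)]
      exact hC s
  have e1 : ∀ x, (∫ s in 0..ε, α (x + s)) * β x = ∫ s in Ioc 0 ε, α (x + s) * β x := by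
    intro x
    rw [intervalIntegral.integral_of_le hε, integral_mul_const]
  simp only [e1]
  refine ⟨hprod.integral_prod_left, ?_, ?_⟩
  · rw [intervalIntegrable_iff_integrableOn_Ioc_of_le hε]
    exact hprod.integral_prod_right
  · rw [intervalIntegral.integral_of_le hε]
    exact integral_integral_swap hprod

theorem integral_norm_mul_le_of_memLp_two {f g : ℝ → ℂ} (hf : MemLp f 2 volume)
    (hg : MemLp g 2 volume) :
    ∫ x, ‖f x * g x‖ ≤ (eLpNorm f 2 volume).toReal * (eLpNorm g 2 volume).toReal := by
  have hi : MemLp (fun x => f x * g x) 1 volume := hg.mul' hf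
  rw [integral_norm_eq_lintegral_enorm hi.1, ← eLpNorm_one_eq_lintegral_enorm, ← ENNReal.toReal_mul]
  refine ENNReal.toReal_mono (ENNReal.mul_ne_top hf.2.ne hg.2.ne) ?_
  exact eLpNorm_smul_le_mul_eLpNorm (φ := f) (f := g) hg.1 hf.1

/-- If `f` has primitive `F`, the inner integral is `F (x + ε) - F x`. Fubini turns the quotient
into an average over `s` in `(0, ε]` of a correlation that is jointly continuous in `(ε, s)`. The
parameter `κ` selects whether the second factor is taken at `x` or at `x + ε`. -/
theorem tendsto_differenceQuotient_two {f g : ℝ → ℂ} (hf : MemLp f 2 volume)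
    (hg : MemLp g 2 volume) (hfm : StronglyMeasurable f) (hgm : StronglyMeasurable g) (κ : ℝ) :
    (∀ ε : ℝ, 0 ≤ ε → Integrable fun x => (∫ s in 0..ε, f (x + s)) * g (x + κ * ε)) ∧
    Tendsto (fun ε : ℝ => (ε : ℂ)⁻¹ * ∫ x, (∫ s in 0..ε, f (x + s)) * g (x + κ * ε)) (𝓝[>] 0)
      (𝓝 (∫ x, f x * g x)) := by
  have hF : ∀ ε : ℝ, 0 ≤ ε → _ := fun ε hε => fubini_translate (ε := ε)
    (β := fun x => g (x + κ * ε)) hfm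
    (hgm.comp_measurable (measurable_add_const (κ * ε)))
    (C := (eLpNorm f 2 volume).toReal * (eLpNorm g 2 volume).toReal)
    (fun s => (hf.comp_add_right s).integrable_mul (hg.comp_add_right (κ * ε)))
    (fun s => by
      refine (integral_norm_mul_le_of_memLp_two (hf.comp_add_right s)
        (hg.comp_add_right (κ * ε))).trans_eq ?_
      congr 2
      · exact eLpNorm_comp_measurePreserving hf.1 (measurePreserving_add_right volume s)
      · exact eLpNorm_comp_measurePreserving hg.1 (measurePreserving_add_right volume (κ * ε))) hε
  refine ⟨fun ε hε => (hF ε hε).1, ?_⟩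
  have hc := continuous_integral_translate (m := fun _ => 1) (memLp_top_const 1) hf hg
  have hK : Tendsto (fun z : ℝ × ℝ => ∫ x, f (x + z.2) * g (x + κ * z.1)) (𝓝 (0, 0))
      (𝓝 (∫ x, f x * g x)) := by
    have h1 : Continuous fun z : ℝ × ℝ => (z.2, κ * z.1) := by fun_prop
    have h2 := (hc.comp h1).tendsto (0, 0)
    simpa [Function.comp_def] using h2
  refine (tendsto_average_of_tendsto (K := fun ε s => ∫ x, f (x + s) * g (x + κ * ε)) hK
    fun ε hε => (hF ε hε.le).2.1).congr' ?_
  filter_upwards [self_mem_nhdsWithin] with ε hε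
  rw [(hF ε (le_of_lt hε)).2.2]

/-- Translation is not continuous in `L^∞`. The substitution that sends `x + s` to `x` frees `m` of
its shift and moves it onto the two `L²` factors. -/
theorem tendsto_differenceQuotient_top {m f g : ℝ → ℂ} (hm : MemLp m ∞ volume)
    (hf : MemLp f 2 volume) (hg : MemLp g 2 volume) (hmm : StronglyMeasurable m)
    (hfm : StronglyMeasurable f) (hgm : StronglyMeasurable g) :
    (∀ ε : ℝ, 0 ≤ ε → Integrable fun x => (∫ s in 0..ε, m (x + s)) * (f x * g (x + ε))) ∧
    Tendsto (fun ε : ℝ => (ε : ℂ)⁻¹ * ∫ x, (∫ s in 0..ε, m (x + s)) * (f x * g (x + ε))) (𝓝[>] 0)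
      (𝓝 (∫ x, m x * (f x * g x))) := by
  obtain ⟨C, hC⟩ : ∃ C : ℝ, ∀ᵐ x ∂(volume : Measure ℝ), ‖m x‖ ≤ C := by
    refine ⟨(eLpNormEssSup m volume).toReal, ?_⟩
    have hlt : eLpNormEssSup m volume < ∞ := by simpa using hm.2
    filter_upwards [ae_le_eLpNormEssSup (f := m) (μ := volume)] with x hx
    rw [← toReal_enorm]
    exact ENNReal.toReal_mono hlt.ne hx
  have hC' : ∀ s, ∀ᵐ x ∂(volume : Measure ℝ), ‖m (x + s)‖ ≤ C := fun s =>
    (measurePreserving_add_right volume s).quasiMeasurePreserving.ae hC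
  have hfg : ∀ ε, Integrable fun x => f x * g (x + ε) := fun ε =>
    hf.integrable_mul (hg.comp_add_right ε)
  have hint : ∀ s ε, Integrable fun x => m (x + s) * (f x * g (x + ε)) := fun s ε =>
    (hfg ε).bdd_mul (hm.comp_add_right s).1 (hC' s)
  have hF : ∀ ε : ℝ, 0 ≤ ε → _ := fun ε hε => fubini_translate (ε := ε)
    (β := fun x => f x * g (x + ε)) hmm
    (hfm.mul (hgm.comp_measurable (measurable_add_const ε)))
    (C := ∫ x, C * ‖f x * g (x + ε)‖)
    (fun s => hint s ε)
    (fun s => by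
      refine integral_mono_ae (hint s ε).norm ((hfg ε).norm.const_mul C) ?_
      filter_upwards [hC' s] with x hx
      rw [norm_mul]
      gcongr) hε
  refine ⟨fun ε hε => (hF ε hε).1, ?_⟩
  have hc := continuous_integral_translate hm hf hg
  have hK : Tendsto (fun z : ℝ × ℝ => ∫ x, m (x + z.2) * (f x * g (x + z.1))) (𝓝 (0, 0))
      (𝓝 (∫ x, m x * (f x * g x))) := by
    have h1 : Continuous fun z : ℝ × ℝ => (-z.2, z.1 - z.2) := by fun_prop
    have h2 := (hc.comp h1).tendsto (0, 0)
    have e : ∀ z : ℝ × ℝ, ∫ x, m (x + z.2) * (f x * g (x + z.1))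
        = ∫ x, m x * (f (x + -z.2) * g (x + (z.1 - z.2))) := by
      intro z
      rw [← integral_add_right_eq_self (fun x => m x * (f (x + -z.2) * g (x + (z.1 - z.2)))) z.2]
      refine integral_congr_ae (Eventually.of_forall fun x => ?_)
      have e1 : x + z.2 + -z.2 = x := by ring
      have e2 : x + z.2 + (z.1 - z.2) = x + z.1 := by ring
      simp only [e1, e2]
    simp only [e]
    simpa [Function.comp_def] using h2
  refine (tendsto_average_of_tendsto (K := fun ε s => ∫ x, m (x + s) * (f x * g (x + ε))) hK
    fun ε hε => (hF ε hε.le).2.1).congr' ?_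
  filter_upwards [self_mem_nhdsWithin] with ε hε
  rw [(hF ε (le_of_lt hε)).2.2]

/-! ### The discrete Leibniz rule and its limit -/

theorem inner_Cvec {r : ℕ} (v w : Cvec r) : inner ℂ v w = ∑ i, w i * starRingEnd ℂ (v i) := by
  rw [PiLp.inner_apply]
  exact Finset.sum_congr rfl fun i _ => RCLike.inner_apply _ _

theorem inner_mact_left {r : ℕ} (M : Matrix (Fin r) (Fin r) ℂ) (v w : Cvec r) :
    inner ℂ (mact M v) w = ∑ i, ∑ j, starRingEnd ℂ (M i j) * (w i * starRingEnd ℂ (v j)) := by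
  rw [inner_Cvec]
  refine Finset.sum_congr rfl fun i _ => ?_
  rw [mact_apply, map_sum, Finset.mul_sum]
  refine Finset.sum_congr rfl fun j _ => ?_
  rw [map_mul]; ring

theorem inner_mact_conjTranspose {r : ℕ} (M : Matrix (Fin r) (Fin r) ℂ) (v w : Cvec r) :
    inner ℂ (mact M v) w = inner ℂ v (mact M.conjTranspose w) := by
  rw [inner_mact_left, inner_Cvec, Finset.sum_comm]
  refine Finset.sum_congr rfl fun j _ => ?_
  rw [mact_apply, Finset.sum_mul]
  refine Finset.sum_congr rfl fun i _ => ?_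
  rw [Matrix.conjTranspose_apply, RCLike.star_def]; ring

theorem Matrix.IsHermitian.inner_mact {r : ℕ} {M : Matrix (Fin r) (Fin r) ℂ} (hM : M.IsHermitian)
    (v w : Cvec r) : inner ℂ (mact M v) w = inner ℂ v (mact M w) := by
  rw [inner_mact_conjTranspose, hM.eq]

theorem mact_sub_left {r : ℕ} (M N : Matrix (Fin r) (Fin r) ℂ) (v : Cvec r) :
    mact (M - N) v = mact M v - mact N v := by
  simp [mact]

theorem mact_add_left {r : ℕ} (M N : Matrix (Fin r) (Fin r) ℂ) (v : Cvec r) :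
    mact (M + N) v = mact M v + mact N v := by
  simp [mact]

theorem StronglyMeasurable.apply_Cvec {r : ℕ} {f : ℝ → Cvec r} (hf : StronglyMeasurable f)
    (i : Fin r) : StronglyMeasurable fun x => f x i :=
  (EuclideanSpace.proj (𝕜 := ℂ) i).continuous.comp_stronglyMeasurable hf

theorem StronglyMeasurable.conj {f : ℝ → ℂ} (hf : StronglyMeasurable f) :
    StronglyMeasurable fun x => starRingEnd ℂ (f x) :=
  Complex.continuous_conj.comp_stronglyMeasurable hf

theorem MeasureTheory.MemLp.conj {f : ℝ → ℂ} {p : ℝ≥0∞} {μ : Measure ℝ} (hf : MemLp f p μ) :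
    MemLp (fun x => starRingEnd ℂ (f x)) p μ :=
  hf.star

theorem intervalIntegral_conj (f : ℝ → ℂ) (a b : ℝ) :
    ∫ x in a..b, starRingEnd ℂ (f x) = starRingEnd ℂ (∫ x in a..b, f x) := by
  simp only [intervalIntegral, integral_conj, map_sub]

/-- Discrete Leibniz rule for `x ↦ p x · V x` where `p = A u`, `Q = A V`. -/
theorem inner_sub_inner_of_isHermitian {r : ℕ} {A A₁ : Matrix (Fin r) (Fin r) ℂ}
    (hA : A.IsHermitian) {u V V₁ p p₁ Q Q₁ : Cvec r} (hp : p = mact A u) (hQ : Q = mact A V)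
    (hQ₁ : Q₁ = mact A₁ V₁) :
    inner ℂ V₁ p₁ - inner ℂ V p
      = inner ℂ V₁ (p₁ - p) + inner ℂ (Q₁ - Q) u - inner ℂ (mact (A₁ - A) V₁) u := by
  rw [mact_sub_left, inner_sub_left, inner_sub_left, inner_sub_right, ← hQ₁, hA.inner_mact V₁ u,
    hQ, hA.inner_mact V u, hp]
  ring

/-- If `V` has compact support in `(a, b)` and `p = A u`, `Q = A V` have derivatives `w`, `Z`, then
the integral of the formal derivative of `p · V` vanishes. -/
theorem integral_leibniz_eq_zero {a b c d : ℝ} (hac : a < c) (hdb : d < b) {r : ℕ}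
    {A A' : ℝ → Matrix (Fin r) (Fin r) ℂ} {u w V Z p Q : ℝ → Cvec r}
    (hA : ∀ x ∈ Ioo a b, (A x).IsHermitian)
    (hAm : ∀ i j, StronglyMeasurable fun x => A' x i j)
    (hA' : ∀ i j, MemLp (fun x => A' x i j) ∞ volume)
    (hAd : ∀ x ∈ Ioo a b, ∀ y ∈ Ioo a b, ∀ i j, A y i j - A x i j = ∫ t in x..y, A' t i j)
    (hu : MemLp u 2 volume) (hum : StronglyMeasurable u)
    (hw : MemLp w 2 volume) (hwm : StronglyMeasurable w)
    (hV : MemLp V 2 volume) (hVm : StronglyMeasurable V)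
    (hZ : MemLp Z 2 volume) (hZm : StronglyMeasurable Z)
    (hp : ∀ x ∈ Ioo a b, ∀ y ∈ Ioo a b, ∀ i, p y i - p x i = ∫ t in x..y, w t i)
    (hpu : ∀ᵐ x ∂(volume : Measure ℝ), x ∈ Ioo a b → p x = mact (A x) (u x))
    (hQ : ∀ x ∈ Ioo a b, ∀ y ∈ Ioo a b, ∀ i, Q y i - Q x i = ∫ t in x..y, Z t i)
    (hQV : ∀ᵐ x ∂(volume : Measure ℝ), x ∈ Ioo a b → Q x = mact (A x) (V x))
    (hV0 : ∀ x, x ∉ Icc c d → V x = 0) (hZ0 : ∀ x, x ∉ Icc c d → Z x = 0)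
    (hh : Integrable fun x => inner ℂ (V x) (p x)) :
    ∫ x, (inner ℂ (V x) (w x) + inner ℂ (Z x) (u x) - inner ℂ (mact (A' x) (V x)) (u x)) = 0 := by
  have hui : ∀ i, MemLp (fun x => u x i) 2 volume := fun i => hu.eval_piLp i
  have hwi : ∀ i, MemLp (fun x => w x i) 2 volume := fun i => hw.eval_piLp i
  have hVi : ∀ i, MemLp (fun x => starRingEnd ℂ (V x i)) 2 volume := fun i => (hV.eval_piLp i).conj
  have hZi : ∀ i, MemLp (fun x => starRingEnd ℂ (Z x i)) 2 volume := fun i => (hZ.eval_piLp i).conj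
  have huim := fun i => StronglyMeasurable.apply_Cvec hum i
  have hwim := fun i => StronglyMeasurable.apply_Cvec hwm i
  have hVim := fun i => StronglyMeasurable.conj (StronglyMeasurable.apply_Cvec hVm i)
  have hZim := fun i => StronglyMeasurable.conj (StronglyMeasurable.apply_Cvec hZm i)
  -- In the discrete Leibniz rule `V` is evaluated at `x + ε`, which is `κ = 1`, while `u` stays at
  -- `x`, which is `κ = 0`.
  have t1 := fun i => tendsto_differenceQuotient_two (hwi i) (hVi i) (hwim i) (hVim i) 1
  have t2 := fun i => tendsto_differenceQuotient_two (hZi i) (hui i) (hZim i) (huim i) 0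
  have t3 := fun i j => tendsto_differenceQuotient_top (hA' i j).conj (hui i) (hVi j)
    (StronglyMeasurable.conj (hAm i j)) (huim i) (hVim j)
  simp only [one_mul, zero_mul, add_zero] at t1 t2
  set η := min (c - a) (b - d) with hη
  have hη0 : 0 < η := lt_min (by linarith) (by linarith)
  -- If `x` is in `[c - ε, d]`, both `x` and `x + ε` lie in `(a, b)` and the discrete rule applies.
  -- Otherwise `V` vanishes at both points and `Z` on the segment between them, so both sides are
  -- zero.
  have hpt : ∀ ε ∈ Ioo 0 η, ∀ᵐ x ∂(volume : Measure ℝ),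
      inner ℂ (V (x + ε)) (p (x + ε)) - inner ℂ (V x) (p x)
        = (∑ i, (∫ s in 0..ε, w (x + s) i) * starRingEnd ℂ (V (x + ε) i))
          + (∑ i, (∫ s in 0..ε, starRingEnd ℂ (Z (x + s) i)) * u x i)
          - ∑ i, ∑ j, (∫ s in 0..ε, starRingEnd ℂ (A' (x + s) i j))
              * (u x i * starRingEnd ℂ (V (x + ε) j)) := by
    intro ε hε
    have hε1 : ε < c - a := hε.2.trans_le (min_le_left _ _)
    have hε2 : ε < b - d := hε.2.trans_le (min_le_right _ _)
    filter_upwards [hpu, hQV, (measurePreserving_add_right volume ε).quasiMeasurePreserving.ae hQV]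
      with x h1 h2 h3
    by_cases hx : x ∈ Icc (c - ε) d
    · have hxI : x ∈ Ioo a b := ⟨by linarith [hx.1], by linarith [hx.2, hε.1]⟩
      have hyI : x + ε ∈ Ioo a b := ⟨by linarith [hx.1], by linarith [hx.2]⟩
      have e1 : ∀ i, ∫ s in 0..ε, w (x + s) i = p (x + ε) i - p x i := fun i => by
        rw [intervalIntegral.integral_comp_add_left (fun t => w t i), add_zero, hp x hxI _ hyI]
      have e2 : ∀ i, ∫ s in 0..ε, Z (x + s) i = Q (x + ε) i - Q x i := fun i => by
        rw [intervalIntegral.integral_comp_add_left (fun t => Z t i), add_zero, hQ x hxI _ hyI]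
      have e3 : ∀ i j, ∫ s in 0..ε, A' (x + s) i j = (A (x + ε) - A x) i j := fun i j => by
        rw [intervalIntegral.integral_comp_add_left (fun t => A' t i j), add_zero,
          ← hAd x hxI _ hyI, Matrix.sub_apply]
      simp only [intervalIntegral_conj, e1, e2, e3]
      rw [inner_sub_inner_of_isHermitian (hA x hxI) (h1 hxI) (h2 hxI) (h3 hyI),
        inner_Cvec, inner_Cvec, inner_mact_left]
      congr 2
      exact Finset.sum_congr rfl fun i _ => mul_comm _ _
    · have hV1 : V x = 0 := hV0 x fun h => hx ⟨by linarith [h.1, hε.1], h.2⟩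
      have hV2 : V (x + ε) = 0 := hV0 _ fun h => hx ⟨by linarith [h.1], by linarith [h.2, hε.1]⟩
      have hZ1 : ∀ s ∈ uIcc 0 ε, Z (x + s) = 0 := by
        intro s hs
        rw [uIcc_of_le hε.1.le] at hs
        exact hZ0 _ fun h => hx ⟨by linarith [h.1, hs.2], by linarith [h.2, hs.1]⟩
      have hZ2 : ∀ i, (∫ s in 0..ε, starRingEnd ℂ (Z (x + s) i)) = 0 := by
        intro i
        rw [intervalIntegral.integral_congr (g := fun _ => (0 : ℂ)),
          intervalIntegral.integral_zero]
        intro s hs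
        simp [hZ1 s hs]
      simp [hV1, hV2, hZ2]
  have hzero : ∀ ε ∈ Ioo 0 η,
      (∑ i, (ε : ℂ)⁻¹ * ∫ x, (∫ s in 0..ε, w (x + s) i) * starRingEnd ℂ (V (x + ε) i))
      + (∑ i, (ε : ℂ)⁻¹ * ∫ x, (∫ s in 0..ε, starRingEnd ℂ (Z (x + s) i)) * u x i)
      - ∑ i, ∑ j, (ε : ℂ)⁻¹ * ∫ x, (∫ s in 0..ε, starRingEnd ℂ (A' (x + s) i j))
              * (u x i * starRingEnd ℂ (V (x + ε) j)) = 0 := by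
    intro ε hε
    -- Translation invariance of the integral: this plays the role of integrating a total
    -- derivative.
    have h0 : ∫ x, (inner ℂ (V (x + ε)) (p (x + ε)) - inner ℂ (V x) (p x)) = 0 := by
      rw [integral_sub (hh.comp_add_right ε) hh,
        integral_add_right_eq_self (fun x => inner ℂ (V x) (p x)) ε, sub_self]
    rw [integral_congr_ae (hpt ε hε)] at h0
    have i1 := integrable_finsetSum Finset.univ fun i _ => (t1 i).1 ε hε.1.le
    have i2 := integrable_finsetSum Finset.univ fun i _ => (t2 i).1 ε hε.1.le
    have i3 := integrable_finsetSum Finset.univ fun i _ =>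
      integrable_finsetSum Finset.univ fun j _ => (t3 i j).1 ε hε.1.le
    rw [integral_sub (i1.fun_add i2) i3, integral_add i1 i2,
      integral_finsetSum _ fun i _ => (t1 i).1 ε hε.1.le,
      integral_finsetSum _ fun i _ => (t2 i).1 ε hε.1.le,
      integral_finsetSum _ fun i _ =>
        integrable_finsetSum Finset.univ fun j _ => (t3 i j).1 ε hε.1.le] at h0
    simp only [← Finset.mul_sum]
    have e3 : ∀ i, ∫ x, ∑ j, (∫ s in 0..ε, starRingEnd ℂ (A' (x + s) i j))
              * (u x i * starRingEnd ℂ (V (x + ε) j))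
        = ∑ j, ∫ x, (∫ s in 0..ε, starRingEnd ℂ (A' (x + s) i j))
              * (u x i * starRingEnd ℂ (V (x + ε) j)) := fun i =>
      integral_finsetSum _ fun j _ => (t3 i j).1 ε hε.1.le
    simp only [e3] at h0
    rw [← mul_add, ← mul_sub, h0, mul_zero]
  have hlim := ((tendsto_finsetSum Finset.univ fun i _ => (t1 i).2).add
    (tendsto_finsetSum Finset.univ fun i _ => (t2 i).2)).sub
    (tendsto_finsetSum Finset.univ fun i _ => tendsto_finsetSum Finset.univ fun j _ => (t3 i j).2)
  have hlim0 : Tendsto (fun _ : ℝ => (0 : ℂ)) (𝓝[>] 0) _ := hlim.congr' (by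
    filter_upwards [Ioo_mem_nhdsGT hη0] with ε hε using hzero ε hε)
  have hfin := tendsto_nhds_unique hlim0 tendsto_const_nhds
  have j1 : ∀ i, Integrable fun x => w x i * starRingEnd ℂ (V x i) := fun i =>
    (hwi i).integrable_mul (hVi i)
  have j2 : ∀ i, Integrable fun x => u x i * starRingEnd ℂ (Z x i) := fun i =>
    (hui i).integrable_mul (hZi i)
  have j3 : ∀ i j, Integrable fun x =>
      starRingEnd ℂ (A' x i j) * (u x i * starRingEnd ℂ (V x j)) := fun i j =>
    memLp_one_iff_integrable.1
      ((memLp_one_iff_integrable.2 ((hui i).integrable_mul (hVi j))).mul' (hA' i j).conj)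
  simp only [inner_mact_left]
  simp only [inner_Cvec]
  rw [integral_sub ((integrable_finsetSum _ fun i _ => j1 i).fun_add
      (integrable_finsetSum _ fun i _ => j2 i))
      (integrable_finsetSum _ fun i _ => integrable_finsetSum _ fun j _ => j3 i j),
    integral_add (integrable_finsetSum _ fun i _ => j1 i) (integrable_finsetSum _ fun i _ => j2 i),
    integral_finsetSum _ fun i _ => j1 i, integral_finsetSum _ fun i _ => j2 i,
    integral_finsetSum _ fun i _ => integrable_finsetSum _ fun j _ => j3 i j]
  rw [← hfin]
  congr 1
  · congr 1
    exact Finset.sum_congr rfl fun i _ => integral_congr_ae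
      (Eventually.of_forall fun x => mul_comm _ _)
  · exact Finset.sum_congr rfl fun i _ => integral_finsetSum _ fun j _ => j3 i j

/-! ### Fluxes and weak differentiability of `A u · v` -/

theorem IsWeakDeriv.sub_eq_integral {a b : ℝ} (hab : a < b) {F : Type*} [NormedAddCommGroup F]
    [NormedSpace ℝ F] [CompleteSpace F] {f g : ℝ → F} (h : IsWeakDeriv a b f g)
    (hg : IntegrableOn g (Ioo a b)) (hf : ContinuousOn f (Icc a b)) :
    ∀ x ∈ Icc a b, ∀ y ∈ Icc a b, f y - f x = ∫ t in x..y, g t := by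
  obtain ⟨c, hc⟩ := h.exists_ae_eq_primitive hab hg
  have he := eqOn_Icc_of_ae_eq hab hf (continuousOn_const_add_primitive hab hg c) hc
  have hgi : IntegrableOn g (Icc a b) :=
    (integrableOn_Icc_iff_integrableOn_Ioo (by simp) (by simp)).2 hg
  have hii : ∀ x ∈ Icc a b, IntervalIntegrable g volume a x := fun x hx =>
    (hgi.mono_set (by rw [uIcc_of_le hx.1]; exact Icc_subset_Icc_right hx.2)).intervalIntegrable
  intro x hx y hy
  rw [he hx, he hy, add_sub_add_left_eq_sub,
    intervalIntegral.integral_interval_sub_left (hii y hy) (hii x hx)]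

theorem MeasureTheory.MemLp.indicator_Ioo {a b : ℝ} {F : Type*} [NormedAddCommGroup F]
    {f : ℝ → F} {p : ℝ≥0∞} (hf : MemLp f p (intervalMeasure a b)) :
    MemLp ((Ioo a b).indicator f) p volume :=
  (memLp_indicator_iff_restrict measurableSet_Ioo).2 hf

namespace FriedrichsCoeff

variable {a b : ℝ} {r : ℕ} (S : FriedrichsCoeff a b r)

/-- `p` is the continuous representative of `A u`, and `w` is its weak derivative. -/
structure IsFlux (u w : L2Space a b r) (p : ℝ → Cvec r) : Prop where
  continuous : Continuous p
  ae_eq : ∀ᵐ x ∂(intervalMeasure a b), p x = mact (S.A x) (u x)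
  weakDeriv : IsWeakDeriv a b p w

variable {S}

theorem A_sub (hab : a < b) (i j : Fin r) : ∀ x ∈ Icc a b, ∀ y ∈ Icc a b,
    S.A y i j - S.A x i j = ∫ t in x..y, S.A' t i j :=
  (S.weakDeriv_A i j).sub_eq_integral hab ((S.memLp_A' i j).integrableOn_Ioo (by simp))
    fun x hx => ((continuous_id.matrix_elem i j).tendsto (S.A x)).comp (S.continuousOn_A x hx)

theorem isHermitian_A (hab : a < b) : ∀ x ∈ Icc a b, (S.A x).IsHermitian := by
  have h1 : ContinuousOn (fun x => (S.A x).conjTranspose) (Icc a b) :=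
    (continuous_id.matrix_conjTranspose).comp_continuousOn S.continuousOn_A
  have h2 : EqOn (fun x => (S.A x).conjTranspose) S.A (Ioo a b) := fun x hx => S.hermitian_A x hx
  exact h2.of_subset_closure h1 S.continuousOn_A Ioo_subset_Icc_self (closure_Ioo hab.ne).superset

theorem memLp_mact_A (u : L2Space a b r) :
    MemLp (fun x => mact (S.A x) (u x)) 2 (intervalMeasure a b) :=
  memLp_mact S.memLp_A (Lp.memLp u)

theorem IsFlux.memLp {u w : L2Space a b r} {p : ℝ → Cvec r} (h : S.IsFlux u w p) :
    MemLp p 2 (intervalMeasure a b) :=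
  (memLp_congr_ae h.ae_eq).2 (S.memLp_mact_A u)

theorem IsFlux.weakDeriv_A {u w : L2Space a b r} {p : ℝ → Cvec r} (h : S.IsFlux u w p) :
    IsWeakDeriv a b (fun x => mact (S.A x) (u x)) w :=
  h.weakDeriv.congr_ae h.ae_eq (EventuallyEq.refl _ _)

theorem _root_.L2Space.integrableOn (u : L2Space a b r) : IntegrableOn u (Ioo a b) :=
  (Lp.memLp u).integrableOn_Ioo (by norm_num)

theorem exists_isFlux (hab : a < b) {u w : L2Space a b r}
    (h : IsWeakDeriv a b (fun x => mact (S.A x) (u x)) w) : ∃ p, S.IsFlux u w p := by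
  obtain ⟨c, hc⟩ := h.exists_ae_eq_primitive hab (L2Space.integrableOn w)
  have hcont := continuousOn_const_add_primitive hab (L2Space.integrableOn w) c
  -- Extension by constants outside `[a, b]` gives a function that is continuous on all of `ℝ`.
  let p : ℝ → Cvec r := IccExtend hab.le ((Icc a b).domRestrict fun x => c + ∫ t in a..x, w t)
  have hp : ∀ x ∈ Icc a b, p x = c + ∫ t in a..x, w t := fun x hx =>
    IccExtend_of_mem hab.le _ hx
  have hae : ∀ᵐ x ∂(intervalMeasure a b), p x = mact (S.A x) (u x) := by
    filter_upwards [hc, ae_restrict_mem measurableSet_Ioo] with x hx hxI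
    rw [hx, hp x (Ioo_subset_Icc_self hxI)]
  exact ⟨p, hcont.domRestrict.Icc_extend', hae, h.congr_ae (hae.mono fun x hx => hx.symm)
    (EventuallyEq.refl _ _)⟩

theorem IsFlux.weakDeriv_apply {u w : L2Space a b r} {p : ℝ → Cvec r} (h : S.IsFlux u w p)
    (i : Fin r) : IsWeakDeriv a b (fun x => p x i) (fun x => w x i) :=
  h.weakDeriv.clm_comp ((EuclideanSpace.proj (𝕜 := ℂ) i).restrictScalars ℝ)

theorem IsFlux.integrableOn_apply {w : L2Space a b r} (i : Fin r) :
    IntegrableOn (fun x => w x i) (Ioo a b) :=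
  ((Lp.memLp w).eval_piLp i).integrableOn_Ioo (by norm_num)

/-- A strongly measurable version of the matrix function `A'`, vanishing outside `(a, b)`. -/
theorem exists_stronglyMeasurable_A' : ∃ A' : ℝ → Matrix (Fin r) (Fin r) ℂ,
    (∀ i j, StronglyMeasurable fun x => A' x i j) ∧
    (∀ i j, MemLp (fun x => A' x i j) ∞ volume) ∧
    ∀ᵐ x ∂(intervalMeasure a b), A' x = S.A' x := by
  refine ⟨fun x => Matrix.of fun i j => (Ioo a b).indicator ((S.memLp_A' i j).1.mk _) x,
    fun i j => ?_, fun i j => ?_, ?_⟩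
  · exact (S.memLp_A' i j).1.stronglyMeasurable_mk.indicator measurableSet_Ioo
  · exact ((memLp_congr_ae (S.memLp_A' i j).1.ae_eq_mk).1 (S.memLp_A' i j)).indicator_Ioo
  · have h : ∀ᵐ x ∂(intervalMeasure a b), ∀ i j,
        S.A' x i j = (S.memLp_A' i j).1.mk _ x :=
      ae_all_iff.2 fun i => ae_all_iff.2 fun j => (S.memLp_A' i j).1.ae_eq_mk
    filter_upwards [h, ae_restrict_mem measurableSet_Ioo] with x hx hxI
    ext i j
    rw [Matrix.of_apply, indicator_of_mem hxI, hx i j]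

/-- The formal derivative of the function `x ↦ A u · v`. -/
def formalDeriv (S : FriedrichsCoeff a b r) (u w v z : L2Space a b r) (x : ℝ) : ℂ :=
  inner ℂ (v x) (w x) + inner ℂ (z x) (u x) - inner ℂ (mact (S.A' x) (v x)) (u x)

theorem integrableOn_formalDeriv (u w v z : L2Space a b r) :
    IntegrableOn (S.formalDeriv u w v z) (Ioo a b) :=
  (((Lp.memLp v).integrable_inner_two (Lp.memLp w)).add
    ((Lp.memLp z).integrable_inner_two (Lp.memLp u))).sub
    ((memLp_mact S.memLp_A' (Lp.memLp v)).integrable_inner_two (Lp.memLp u))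

/-- The function `A u · v` is weakly differentiable for `u`, `v` in the graph space. -/
theorem IsFlux.isWeakDeriv_inner (hab : a < b) {u w v z : L2Space a b r} {p q : ℝ → Cvec r}
    (hu : S.IsFlux u w p) (hv : S.IsFlux v z q) :
    IsWeakDeriv a b (fun x => inner ℂ (v x) (p x)) (S.formalDeriv u w v z) := by
  have hint : IntegrableOn (fun x => inner ℂ (v x) (p x)) (Ioo a b) :=
    (Lp.memLp v).integrable_inner_two hu.memLp
  have hkint := S.integrableOn_formalDeriv u w v z
  refine ⟨hint.locallyIntegrableOn, hkint.locallyIntegrableOn, fun χ => ?_⟩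
  obtain ⟨c, d, hac, -, hdb, hχ⟩ := χ.exists_Icc hab
  have hsub : Icc c d ⊆ Ioo a b := fun x hx => ⟨hac.trans_le hx.1, hx.2.trans_lt hdb⟩
  have hχ' : ∀ x, x ∉ Icc c d → deriv χ x = 0 := by
    intro x hx
    have hev : (χ : ℝ → ℝ) =ᶠ[𝓝 x] fun _ => 0 := by
      filter_upwards [isClosed_Icc.isOpen_compl.mem_nhds hx] with y hy using hχ y hy
    rw [hev.deriv_eq, deriv_const]
  have hχb : ∃ C : ℝ, ∀ x, ‖χ x‖ ≤ C :=
    χ.continuous.bounded_above_of_compact_support χ.hasCompactSupport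
  have hχb' : ∃ C : ℝ, ∀ x, ‖deriv χ x‖ ≤ C :=
    χ.continuous_deriv.bounded_above_of_compact_support χ.hasCompactSupport_deriv
  have hmem : ∀ {ψ : ℝ → ℝ} {f : ℝ → Cvec r}, (∃ C : ℝ, ∀ x, ‖ψ x‖ ≤ C) → Continuous ψ →
      (∀ x, x ∉ Icc c d → ψ x = 0) → MemLp f 2 (intervalMeasure a b) →
      MemLp (fun x => ψ x • f x) 2 volume := by
    intro ψ f ⟨C, hC⟩ hψc hψ0 hf
    have h1 : MemLp (fun x => ψ x • f x) 2 (intervalMeasure a b) :=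
      hf.smul (memLp_top_of_bound hψc.aestronglyMeasurable C (Eventually.of_forall hC))
    have h2 : (fun x => ψ x • f x) = (Ioo a b).indicator fun x => ψ x • f x := by
      funext x
      by_cases hx : x ∈ Ioo a b
      · rw [indicator_of_mem hx]
      · rw [indicator_of_notMem hx, hψ0 x fun h => hx (hsub h), zero_smul]
    rw [h2]
    exact h1.indicator_Ioo
  -- The Fubini argument on the whole line needs a strongly measurable `A'`; the given one is only
  -- almost everywhere equal to such a function.
  obtain ⟨A', hAm, hA', hAae⟩ := S.exists_stronglyMeasurable_A'
  rw [ae_restrict_iff' measurableSet_Ioo] at hAae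
  have hVmem : MemLp (fun x => χ x • v x) 2 volume := hmem hχb χ.continuous hχ (Lp.memLp v)
  -- The cut-off `χ` is put on `v`: the flux of `χ v` is `χ q`, with derivative `χ z + χ' q`. The
  -- functions `u` and `w` are extended by zero.
  have key := integral_leibniz_eq_zero (a := a) (b := b) hac hdb
    (A := S.A) (A' := A') (u := (Ioo a b).indicator u) (w := (Ioo a b).indicator w)
    (V := fun x => χ x • v x) (Z := fun x => χ x • z x + deriv χ x • q x) (p := p)
    (Q := fun x => χ x • q x)
    (fun x hx => S.hermitian_A x hx) hAm hA'
    (fun x hx y hy i j => by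
      rw [A_sub hab i j x (Ioo_subset_Icc_self hx) y (Ioo_subset_Icc_self hy)]
      refine intervalIntegral.integral_congr_ae ?_
      filter_upwards [hAae] with t ht htI
      have htI' : t ∈ Ioo a b := ordConnected_Ioo.uIcc_subset hx hy (uIoc_subset_uIcc htI)
      rw [ht htI'])
    (Lp.memLp u).indicator_Ioo ((Lp.stronglyMeasurable u).indicator measurableSet_Ioo)
    (Lp.memLp w).indicator_Ioo ((Lp.stronglyMeasurable w).indicator measurableSet_Ioo)
    hVmem (χ.continuous.stronglyMeasurable.smul (Lp.stronglyMeasurable v))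
    ((hmem hχb χ.continuous hχ (Lp.memLp z)).add
      (hmem hχb' χ.continuous_deriv hχ' hv.memLp))
    ((χ.continuous.stronglyMeasurable.smul (Lp.stronglyMeasurable z)).add
      (χ.continuous_deriv.stronglyMeasurable.smul hv.continuous.stronglyMeasurable))
    (fun x hx y hy i => by
      rw [(hu.weakDeriv_apply i).sub_eq_integral hab (IsFlux.integrableOn_apply i)
        ((EuclideanSpace.proj (𝕜 := ℂ) i).continuous.comp hu.continuous).continuousOn
        x (Ioo_subset_Icc_self hx) y (Ioo_subset_Icc_self hy)]
      refine intervalIntegral.integral_congr fun t ht => ?_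
      simp only [indicator_of_mem (ordConnected_Ioo.uIcc_subset hx hy ht)])
    (by
      filter_upwards [(ae_restrict_iff' measurableSet_Ioo).1 hu.ae_eq] with x hx hxI
      rw [indicator_of_mem hxI, hx hxI])
    (fun x hx y hy i => by
      have hs : ContDiff ℝ (⊤ : ℕ∞) fun x => (χ x : ℂ) := Complex.ofRealCLM.contDiff.comp χ.contDiff
      have hd : ∀ x, deriv (fun x => (χ x : ℂ)) x = (deriv χ x : ℝ) := fun x =>
        (Complex.ofRealCLM.hasFDerivAt.comp_hasDerivAt x (χ.hasDerivAt x)).deriv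
      have hwd := (hv.weakDeriv_apply i).smul_smooth hs
      simp only [hd] at hwd
      have hqi : Continuous fun x => q x i :=
        (EuclideanSpace.proj (𝕜 := ℂ) i).continuous.comp hv.continuous
      have hc1 : Continuous fun x => q x i * (χ x : ℂ) := hqi.mul hs.continuous
      have hc2 : Continuous fun x => q x i * ((deriv χ x : ℝ) : ℂ) :=
        hqi.mul (Complex.continuous_ofReal.comp χ.continuous_deriv)
      have hi2 : IntegrableOn (fun x => z x i * (χ x : ℂ)) (Ioo a b) := by
        obtain ⟨C, hC⟩ := hχb
        exact Integrable.mul_bdd (c := C) (IsFlux.integrableOn_apply i)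
          hs.continuous.aestronglyMeasurable (Eventually.of_forall fun x => by
            rw [Complex.norm_real]; exact hC x)
      have h := hwd.sub_eq_integral hab
        ((hc2.continuousOn.integrableOn_Icc.mono_set Ioo_subset_Icc_self).add hi2)
        hc1.continuousOn x (Ioo_subset_Icc_self hx) y (Ioo_subset_Icc_self hy)
      simp only [PiLp.smul_apply, PiLp.add_apply, Complex.real_smul]
      rw [mul_comm (χ y : ℂ), mul_comm (χ x : ℂ), h]
      refine intervalIntegral.integral_congr fun t _ => ?_
      ring)
    (by
      filter_upwards [(ae_restrict_iff' measurableSet_Ioo).1 hv.ae_eq] with x hx hxI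
      rw [hx hxI, mact, mact, ← Complex.coe_smul, ← Complex.coe_smul, map_smul])
    (fun x hx => by simp only [hχ x hx, zero_smul])
    (fun x hx => by simp only [hχ x hx, hχ' x hx, zero_smul, add_zero])
    (by
      rw [← integrableOn_iff_integrable_of_support_subset (s := Ioo a b)]
      · exact (hVmem.restrict _).integrable_inner_two hu.memLp
      · intro x hx
        by_contra hxI
        refine hx ?_
        simp only [hχ x fun h => hxI (hsub h), zero_smul, inner_zero_left])
  rw [← setIntegral_eq_integral_of_forall_compl_eq_zero (s := Ioo a b) (fun x hx => by
    simp only [hχ x fun h => hx (hsub h), hχ' x fun h => hx (hsub h), zero_smul, add_zero,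
      inner_zero_left, mact, map_zero, sub_zero])] at key
  have hcongr : ∀ᵐ x ∂(intervalMeasure a b),
      inner ℂ (χ x • v x) ((Ioo a b).indicator w x)
        + inner ℂ (χ x • z x + deriv χ x • q x) ((Ioo a b).indicator u x)
        - inner ℂ (mact (A' x) (χ x • v x)) ((Ioo a b).indicator u x)
      = deriv χ x • inner ℂ (v x) (p x) + χ x • S.formalDeriv u w v z x := by
    filter_upwards [(ae_restrict_iff' measurableSet_Ioo).2 hAae, hu.ae_eq, hv.ae_eq,
      ae_restrict_mem measurableSet_Ioo] with x h1 h2 h3 hxI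
    -- The two ways of writing `A u · v` agree because `A` is Hermitian; this converts the term with
    -- `χ'` to the tested function.
    have h4 : inner ℂ (q x) (u x) = inner ℂ (v x) (p x) := by
      rw [h3, h2, (S.hermitian_A x hxI).inner_mact]
    have h5 : mact (S.A' x) (χ x • v x) = χ x • mact (S.A' x) (v x) := by
      rw [mact, mact, ← Complex.coe_smul, ← Complex.coe_smul, map_smul]
    rw [indicator_of_mem hxI, indicator_of_mem hxI, h1, h5, inner_add_left, inner_smul_left_eq_smul,
      inner_smul_left_eq_smul, inner_smul_left_eq_smul, inner_smul_left_eq_smul, h4, formalDeriv,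
      smul_sub, smul_add]
    ring
  rw [integral_congr_ae hcongr, integral_add (χ.integrableOn_deriv_smul hint.locallyIntegrableOn)
    (χ.integrableOn_smul hkint.locallyIntegrableOn)] at key
  exact eq_neg_of_add_eq_zero_left key

/-- The product `A u · v` agrees almost everywhere with a constant plus the primitive of its
integrable weak derivative, and this primitive is continuous up to the end-points. -/
theorem IsFlux.exists_continuousOn_inner (hab : a < b) {u w v z : L2Space a b r} {p q : ℝ → Cvec r}
    (hu : S.IsFlux u w p) (hv : S.IsFlux v z q) :
    ∃ H : ℝ → ℂ, ContinuousOn H (Icc a b) ∧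
      (∀ᵐ x ∂(intervalMeasure a b), H x = inner ℂ (v x) (p x)) ∧
      H b - H a = ∫ x in Ioo a b, S.formalDeriv u w v z x := by
  have hint := S.integrableOn_formalDeriv u w v z
  obtain ⟨c, hc⟩ := (hu.isWeakDeriv_inner hab hv).exists_ae_eq_primitive hab hint
  refine ⟨_, continuousOn_const_add_primitive hab hint c, hc.mono fun x hx => hx.symm, ?_⟩
  rw [intervalIntegral.integral_same, add_sub_add_left_eq_sub, sub_zero,
    intervalIntegral.integral_of_le hab.le, integral_Ioc_eq_integral_Ioo]

end FriedrichsCoeff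

/-! ### Adjoints and closures of the Friedrichs operators -/

theorem IsWeakDeriv.of_apply {a b : ℝ} {r : ℕ} {f g : ℝ → Cvec r}
    (h : ∀ i, IsWeakDeriv a b (fun x => f x i) (fun x => g x i)) : IsWeakDeriv a b f g := by
  have h1 := IsWeakDeriv.sum Finset.univ fun i _ => (h i).clm_comp
    (((ContinuousLinearMap.id ℂ ℂ).smulRight
      (EuclideanSpace.single i (1 : ℂ) : Cvec r)).restrictScalars ℝ)
  have e : ∀ v : Cvec r, ∑ i, (((ContinuousLinearMap.id ℂ ℂ).smulRight
      (EuclideanSpace.single i (1 : ℂ) : Cvec r)).restrictScalars ℝ) (v i) = v := by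
    intro v
    ext j
    simp [Pi.single_apply]
  refine h1.congr_ae (Eventually.of_forall fun x => e (f x)) (Eventually.of_forall fun x => e (g x))

theorem opOnTest_apply {a b : ℝ} {r : ℕ} (L : 𝓓(openIoo a b, Cvec r) →ₗ[ℂ] L2Space a b r)
    (φ : 𝓓(openIoo a b, Cvec r)) :
    opOnTest L ⟨testToL2 a b r φ, LinearMap.mem_range_self _ φ⟩ = L φ := by
  change L ((LinearEquiv.ofInjective (testToL2 a b r) (testToL2_injective a b r)).symm
    ⟨testToL2 a b r φ, LinearMap.mem_range_self _ φ⟩) = L φ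
  congr 1
  rw [LinearEquiv.symm_apply_eq]
  rfl

namespace FriedrichsCoeff

variable {a b : ℝ} {r : ℕ} {S : FriedrichsCoeff a b r}

theorem forall_T_domain {P : S.T.domain → Prop} : (∀ x, P x) ↔
    ∀ φ, P ⟨testToL2 a b r φ, LinearMap.mem_range_self _ φ⟩ :=
  ⟨fun h φ => h _, by rintro h ⟨_, φ, rfl⟩; exact h φ⟩

theorem forall_Ttilde_domain {P : S.Ttilde.domain → Prop} : (∀ x, P x) ↔
    ∀ φ, P ⟨testToL2 a b r φ, LinearMap.mem_range_self _ φ⟩ :=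
  ⟨fun h φ => h _, by rintro h ⟨_, φ, rfl⟩; exact h φ⟩

theorem T_apply (φ : 𝓓(openIoo a b, Cvec r)) :
    S.T ⟨testToL2 a b r φ, LinearMap.mem_range_self _ φ⟩ = (S.memLp_opFun φ).toLp (S.opFun φ) :=
  opOnTest_apply _ φ

theorem Ttilde_apply (φ : 𝓓(openIoo a b, Cvec r)) :
    S.Ttilde ⟨testToL2 a b r φ, LinearMap.mem_range_self _ φ⟩
      = (S.memLp_opFunTilde φ).toLp (S.opFunTilde φ) :=
  opOnTest_apply _ φ

theorem dense_T_domain : Dense (S.T.domain : Set (L2Space a b r)) := dense_range_testToL2 a b r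

theorem dense_Ttilde_domain : Dense (S.Ttilde.domain : Set (L2Space a b r)) :=
  dense_range_testToL2 a b r

theorem memLp_AB (i j : Fin r) :
    MemLp (fun x => (S.A' x + S.B x).conjTranspose i j) ∞ (intervalMeasure a b) :=
  ((S.memLp_A' j i).add (S.memLp_B j i)).star

variable (S) in
/-- Multiplication by `B`. -/
def mulB (u : L2Space a b r) : L2Space a b r := (memLp_mact S.memLp_B (Lp.memLp u)).toLp _

variable (S) in
/-- Multiplication by `(A' + B)*`. -/
def mulAB (u : L2Space a b r) : L2Space a b r := (memLp_mact S.memLp_AB (Lp.memLp u)).toLp _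

theorem coeFn_mulB (u : L2Space a b r) :
    S.mulB u =ᵐ[intervalMeasure a b] fun x => mact (S.B x) (u x) :=
  MemLp.coeFn_toLp _

theorem coeFn_mulAB (u : L2Space a b r) :
    S.mulAB u =ᵐ[intervalMeasure a b] fun x => mact (S.A' x + S.B x).conjTranspose (u x) :=
  MemLp.coeFn_toLp _

theorem inner_testToL2 (w : L2Space a b r) (φ : 𝓓(openIoo a b, Cvec r)) :
    inner ℂ w (testToL2 a b r φ) = ∫ x in Ioo a b, inner ℂ (w x) (φ x) := by
  rw [L2.inner_def]
  refine integral_congr_ae ?_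
  filter_upwards [(memLp_testFunction φ).coeFn_toLp] with x hx
  change inner ℂ (w x) (((memLp_testFunction φ).toLp φ : L2Space a b r) x) = _
  rw [hx]

theorem integrable_inner_A_deriv (u : L2Space a b r) (φ : 𝓓(openIoo a b, Cvec r)) :
    Integrable (fun x => inner ℂ (mact (S.A x) (u x)) (deriv φ x)) (intervalMeasure a b) :=
  (S.memLp_mact_A u).integrable_inner_two (memLp_deriv_testFunction φ)

/-- The terms `-A' φ` and `A' φ` in `T̃ φ` cancel, leaving `-A φ' + B* φ`; both matrices are then
moved to `u`. -/
theorem inner_Ttilde (u : L2Space a b r) (φ : 𝓓(openIoo a b, Cvec r)) :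
    inner ℂ u ((S.memLp_opFunTilde φ).toLp (S.opFunTilde φ))
      = -(∫ x in Ioo a b, inner ℂ (mact (S.A x) (u x)) (deriv φ x))
        + ∫ x in Ioo a b, inner ℂ (S.mulB u x) (φ x) := by
  rw [L2.inner_def, ← integral_neg, ← integral_add (integrable_inner_A_deriv u φ).fun_neg
    ((Lp.memLp (S.mulB u)).integrable_inner_two (memLp_testFunction φ))]
  refine integral_congr_ae ?_
  filter_upwards [(S.memLp_opFunTilde φ).coeFn_toLp, S.coeFn_mulB u,
    ae_restrict_mem measurableSet_Ioo] with x h1 h2 hx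
  rw [h1, h2, (S.hermitian_A x hx).inner_mact, inner_mact_conjTranspose, opFunTilde, derivA,
    mact_add_left, ← inner_neg_right, ← inner_add_right]
  congr 1
  abel

theorem inner_T (u : L2Space a b r) (φ : 𝓓(openIoo a b, Cvec r)) :
    inner ℂ u ((S.memLp_opFun φ).toLp (S.opFun φ))
      = (∫ x in Ioo a b, inner ℂ (mact (S.A x) (u x)) (deriv φ x))
        + ∫ x in Ioo a b, inner ℂ (S.mulAB u x) (φ x) := by
  rw [L2.inner_def, ← integral_add (integrable_inner_A_deriv u φ)
    ((Lp.memLp (S.mulAB u)).integrable_inner_two (memLp_testFunction φ))]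
  refine integral_congr_ae ?_
  filter_upwards [(S.memLp_opFun φ).coeFn_toLp, S.coeFn_mulAB u,
    ae_restrict_mem measurableSet_Ioo] with x h1 h2 hx
  rw [h1, h2, (S.hermitian_A x hx).inner_mact, inner_mact_conjTranspose,
    Matrix.conjTranspose_conjTranspose, opFun, derivA, mact_add_left, ← inner_add_right]
  congr 1
  abel

theorem isWeakDeriv_iff_inner_Lp (u g : L2Space a b r) :
    IsWeakDeriv a b (fun x => mact (S.A x) (u x)) g ↔ ∀ φ : 𝓓(openIoo a b, Cvec r),
      ∫ x in Ioo a b, inner ℂ (mact (S.A x) (u x)) (deriv φ x)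
        = - ∫ x in Ioo a b, inner ℂ (g x) (φ x) :=
  isWeakDeriv_iff_inner (S.memLp_mact_A u) (Lp.memLp g)

theorem integral_inner_testToL2 (g : L2Space a b r) (φ : 𝓓(openIoo a b, Cvec r)) :
    ∫ x in Ioo a b, inner ℂ (g x) (φ x) = inner ℂ g (testToL2 a b r φ) :=
  (inner_testToL2 g φ).symm

/-- The right side is the defining relation of the adjoint of `T̃`. This gives at once its domain,
the graph space, and its action `u ↦ (A u)' + B u`. -/
theorem isWeakDeriv_iff_Ttilde (u g : L2Space a b r) :
    IsWeakDeriv a b (fun x => mact (S.A x) (u x)) g ↔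
      ∀ x : S.Ttilde.domain, inner ℂ (g + S.mulB u) (x : L2Space a b r) = inner ℂ u (S.Ttilde x) := by
  rw [isWeakDeriv_iff_inner_Lp, forall_Ttilde_domain]
  refine forall_congr' fun φ => ?_
  rw [Ttilde_apply, inner_Ttilde, inner_add_left, integral_inner_testToL2, integral_inner_testToL2]
  constructor <;> intro h
  · rw [h]; ring
  · linear_combination h

/-- The same for the adjoint of `T`, which acts as `u ↦ -(A u)' + (A' + B)* u`. -/
theorem isWeakDeriv_iff_T (u g : L2Space a b r) :
    IsWeakDeriv a b (fun x => mact (S.A x) (u x)) g ↔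
      ∀ x : S.T.domain, inner ℂ (-g + S.mulAB u) (x : L2Space a b r) = inner ℂ u (S.T x) := by
  rw [isWeakDeriv_iff_inner_Lp, forall_T_domain]
  refine forall_congr' fun φ => ?_
  rw [T_apply, inner_T, inner_add_left, inner_neg_left, integral_inner_testToL2,
    integral_inner_testToL2]
  constructor <;> intro h
  · rw [h]
  · linear_combination -h

theorem mem_T₁_domain_iff (u : L2Space a b r) : u ∈ S.T₁.domain ↔ u ∈ S.graphSpace := by
  constructor
  · intro hu
    refine ⟨S.T₁ ⟨u, hu⟩ - S.mulB u, (isWeakDeriv_iff_Ttilde u _).2 fun x => ?_⟩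
    rw [sub_add_cancel]
    exact LinearPMap.adjoint_isFormalAdjoint S.dense_Ttilde_domain ⟨u, hu⟩ x
  · rintro ⟨w, hw⟩
    exact LinearPMap.mem_adjoint_domain_of_exists _ ⟨_, (isWeakDeriv_iff_Ttilde u w).1 hw⟩

theorem mem_Ttilde₁_domain_iff (u : L2Space a b r) : u ∈ S.Ttilde₁.domain ↔ u ∈ S.graphSpace := by
  constructor
  · intro hu
    refine ⟨S.mulAB u - S.Ttilde₁ ⟨u, hu⟩, (isWeakDeriv_iff_T u _).2 fun x => ?_⟩
    rw [neg_sub, sub_add_cancel]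
    exact LinearPMap.adjoint_isFormalAdjoint S.dense_T_domain ⟨u, hu⟩ x
  · rintro ⟨w, hw⟩
    exact LinearPMap.mem_adjoint_domain_of_exists _ ⟨_, (isWeakDeriv_iff_T u w).1 hw⟩

theorem T₁_apply (u : S.T₁.domain) {w : L2Space a b r}
    (h : IsWeakDeriv a b (fun x => mact (S.A x) ((u : L2Space a b r) x)) w) :
    S.T₁ u = w + S.mulB u :=
  LinearPMap.adjoint_apply_eq S.dense_Ttilde_domain u ((isWeakDeriv_iff_Ttilde _ w).1 h)

theorem Ttilde₁_apply (u : S.Ttilde₁.domain) {w : L2Space a b r}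
    (h : IsWeakDeriv a b (fun x => mact (S.A x) ((u : L2Space a b r) x)) w) :
    S.Ttilde₁ u = -w + S.mulAB u :=
  LinearPMap.adjoint_apply_eq S.dense_T_domain u ((isWeakDeriv_iff_T _ w).1 h)

/-- By symmetry of `A`, the conjugate of the `(j, i)` entry of `A'` is also a weak derivative of the
`(i, j)` entry of `A`; weak derivatives are unique. -/
theorem isHermitian_A' : ∀ᵐ x ∂(intervalMeasure a b), (S.A' x).IsHermitian := by
  have h : ∀ᵐ x ∂(intervalMeasure a b), ∀ i j, starRingEnd ℂ (S.A' x j i) = S.A' x i j := by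
    refine ae_all_iff.2 fun i => ae_all_iff.2 fun j => ?_
    have h1 := (S.weakDeriv_A j i).clm_comp (Complex.conjCLE : ℂ →L[ℝ] ℂ)
    have h2 : IsWeakDeriv a b (fun x => S.A x i j) fun x => starRingEnd ℂ (S.A' x j i) := by
      refine h1.congr_ae ?_ (Eventually.of_forall fun x => rfl)
      filter_upwards [ae_restrict_mem measurableSet_Ioo] with x hx
      exact (S.hermitian_A x hx).apply i j
    exact h2.ae_unique (S.weakDeriv_A i j)
  filter_upwards [h] with x hx
  ext i j
  exact hx i j

variable (S) in
/-- Product rule for `A ζ` with smooth `ζ`. -/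
theorem isWeakDeriv_mact_smooth {ζ : ℝ → Cvec r} (hζ : ContDiff ℝ (⊤ : ℕ∞) ζ) :
    IsWeakDeriv a b (fun x => mact (S.A x) (ζ x))
      (fun x => mact (S.A x) (deriv ζ x) + mact (S.A' x) (ζ x)) := by
  refine IsWeakDeriv.of_apply fun i => ?_
  have hj : ∀ j, ContDiff ℝ (⊤ : ℕ∞) fun x => ζ x j := fun j =>
    ((EuclideanSpace.proj (𝕜 := ℂ) j).restrictScalars ℝ).contDiff.comp hζ
  have hd : ∀ j x, deriv (fun x => ζ x j) x = deriv ζ x j := fun j x =>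
    (((EuclideanSpace.proj (𝕜 := ℂ) j).restrictScalars ℝ).hasFDerivAt.comp_hasDerivAt x
      (hζ.differentiable (by simp) x).hasDerivAt).deriv
  have h := IsWeakDeriv.sum Finset.univ fun j _ => (S.weakDeriv_A i j).smul_smooth (hj j)
  simp only [hd, Finset.sum_add_distrib] at h
  simpa only [PiLp.add_apply, mact_apply] using h

variable (S) in
theorem isWeakDeriv_testToL2 (φ : 𝓓(openIoo a b, Cvec r)) :
    IsWeakDeriv a b (fun x => mact (S.A x) (testToL2 a b r φ x))
      ((S.memLp_derivA φ).toLp (S.derivA φ) : L2Space a b r) := by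
  refine (S.isWeakDeriv_mact_smooth φ.contDiff).congr_ae ?_ (S.memLp_derivA φ).coeFn_toLp.symm
  filter_upwards [(memLp_testFunction φ).coeFn_toLp] with x hx
  change _ = mact (S.A x) (((memLp_testFunction φ).toLp φ : L2Space a b r) x)
  rw [hx]

theorem coeFn_testToL2 (φ : 𝓓(openIoo a b, Cvec r)) :
    testToL2 a b r φ =ᵐ[intervalMeasure a b] φ := (memLp_testFunction φ).coeFn_toLp

/-- `T₁` is an adjoint, hence closed, so this inclusion makes `T` closable. It also identifies `T₀`
through the boundary form. -/
theorem T_le_T₁ : S.T ≤ S.T₁ := by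
  refine ⟨fun u hu => ?_, ?_⟩
  · obtain ⟨φ, rfl⟩ := hu
    exact (mem_T₁_domain_iff _).2 ⟨_, S.isWeakDeriv_testToL2 φ⟩
  · rintro ⟨u, hu⟩ ⟨v, hv⟩ huv
    obtain ⟨φ, rfl⟩ := hu
    obtain rfl : testToL2 a b r φ = v := huv
    rw [T₁_apply ⟨_, hv⟩ (S.isWeakDeriv_testToL2 φ), T_apply]
    refine Lp.ext ?_
    filter_upwards [(S.memLp_opFun φ).coeFn_toLp, Lp.coeFn_add
      ((S.memLp_derivA φ).toLp (S.derivA φ)) (S.mulB (testToL2 a b r φ)),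
      (S.memLp_derivA φ).coeFn_toLp, S.coeFn_mulB (testToL2 a b r φ), coeFn_testToL2 φ]
      with x h1 h2 h3 h4 h5
    rw [h1, h2, Pi.add_apply, h3, h4, h5, opFun]

theorem Ttilde_le_Ttilde₁ : S.Ttilde ≤ S.Ttilde₁ := by
  refine ⟨fun u hu => ?_, ?_⟩
  · obtain ⟨φ, rfl⟩ := hu
    exact (mem_Ttilde₁_domain_iff _).2 ⟨_, S.isWeakDeriv_testToL2 φ⟩
  · rintro ⟨u, hu⟩ ⟨v, hv⟩ huv
    obtain ⟨φ, rfl⟩ := hu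
    obtain rfl : testToL2 a b r φ = v := huv
    rw [Ttilde₁_apply ⟨_, hv⟩ (S.isWeakDeriv_testToL2 φ), Ttilde_apply]
    refine Lp.ext ?_
    filter_upwards [(S.memLp_opFunTilde φ).coeFn_toLp, Lp.coeFn_add
      (-(S.memLp_derivA φ).toLp (S.derivA φ)) (S.mulAB (testToL2 a b r φ)),
      Lp.coeFn_neg ((S.memLp_derivA φ).toLp (S.derivA φ)),
      (S.memLp_derivA φ).coeFn_toLp, S.coeFn_mulAB (testToL2 a b r φ), coeFn_testToL2 φ,
      S.isHermitian_A'] with x h1 h2 h3 h4 h5 h6 h7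
    rw [h1, h2, Pi.add_apply, h3, Pi.neg_apply, h4, h5, h6, opFunTilde, Matrix.conjTranspose_add,
      h7.eq, add_comm (S.A' x)]

theorem isClosable_T : S.T.IsClosable :=
  LinearPMap.isClosable_iff_exists_closed_extension.2
    ⟨S.T₁, LinearPMap.adjoint_isClosed S.dense_Ttilde_domain, T_le_T₁⟩

theorem isClosable_Ttilde : S.Ttilde.IsClosable :=
  LinearPMap.isClosable_iff_exists_closed_extension.2
    ⟨S.Ttilde₁, LinearPMap.adjoint_isClosed S.dense_T_domain, Ttilde_le_Ttilde₁⟩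

theorem boundaryForm_eq_zero_iff (u : S.T₁.domain) (v : S.Ttilde₁.domain) :
    S.boundaryForm u v = 0 ↔
      inner ℂ (S.T₁ u) (v : L2Space a b r) = inner ℂ (u : L2Space a b r) (S.Ttilde₁ v) := by
  rw [boundaryForm, scp, scp, sub_eq_zero, ← inner_conj_symm, ← inner_conj_symm (S.Ttilde₁ v)]
  exact (starRingEnd ℂ).injective.eq_iff

theorem boundaryForm_eq_zero_iff_inner (u : S.T₁.domain) (v : S.Ttilde₁.domain) :
    S.boundaryForm u v = 0 ↔
      inner ℂ (v : L2Space a b r) (S.T₁ u) = inner ℂ (S.Ttilde₁ v) (u : L2Space a b r) := by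
  rw [boundaryForm, scp, scp, sub_eq_zero]

/-- The domain of the closure consists of the `u` having some `f` with `⟨f, v⟩ = ⟨u, T̃₁ v⟩` for all
`v` in the domain of `T̃₁`. Restricting to `v` in the domain of `T̃` forces `u` into the domain of
`T₁` and `f = T₁ u`, and the condition becomes the vanishing of the boundary form. -/
theorem mem_T₀_domain_iff (u : L2Space a b r) :
    u ∈ S.T₀.domain ↔ ∃ h : u ∈ S.T₁.domain, ∀ v, S.boundaryForm ⟨u, h⟩ v = 0 := by
  have hiff := LinearPMap.mem_closure_domain_iff S.dense_T_domain S.isClosable_T u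
  constructor
  · intro hu
    obtain ⟨f, hf⟩ := hiff.1 hu
    have hf' : ∀ x : S.Ttilde.domain, inner ℂ f (x : L2Space a b r) = inner ℂ u (S.Ttilde x) := by
      intro x
      have h := hf ⟨x, Ttilde_le_Ttilde₁.1 x.2⟩
      rw [Ttilde_le_Ttilde₁.2 (y := ⟨x, Ttilde_le_Ttilde₁.1 x.2⟩) rfl]
      exact h
    have hd : u ∈ S.T₁.domain := LinearPMap.mem_adjoint_domain_of_exists _ ⟨f, hf'⟩
    have he : S.T₁ ⟨u, hd⟩ = f := LinearPMap.adjoint_apply_eq S.dense_Ttilde_domain _ hf'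
    refine ⟨hd, fun v => (boundaryForm_eq_zero_iff _ v).2 ?_⟩
    rw [he]
    exact hf v
  · rintro ⟨h, hv⟩
    exact hiff.2 ⟨S.T₁ ⟨u, h⟩, fun v => (boundaryForm_eq_zero_iff _ v).1 (hv v)⟩

theorem mem_Ttilde₀_domain_iff (u : L2Space a b r) :
    u ∈ S.Ttilde₀.domain ↔ ∃ h : u ∈ S.Ttilde₁.domain, ∀ v, S.boundaryForm v ⟨u, h⟩ = 0 := by
  have hiff := LinearPMap.mem_closure_domain_iff S.dense_Ttilde_domain S.isClosable_Ttilde u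
  constructor
  · intro hu
    obtain ⟨f, hf⟩ := hiff.1 hu
    have hf' : ∀ x : S.T.domain, inner ℂ f (x : L2Space a b r) = inner ℂ u (S.T x) := by
      intro x
      have h := hf ⟨x, T_le_T₁.1 x.2⟩
      rw [T_le_T₁.2 (y := ⟨x, T_le_T₁.1 x.2⟩) rfl]
      exact h
    have hd : u ∈ S.Ttilde₁.domain := LinearPMap.mem_adjoint_domain_of_exists _ ⟨f, hf'⟩
    have he : S.Ttilde₁ ⟨u, hd⟩ = f := LinearPMap.adjoint_apply_eq S.dense_T_domain _ hf'
    refine ⟨hd, fun v => ?_⟩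
    rw [boundaryForm_eq_zero_iff_inner, he]
    exact (hf v).symm
  · rintro ⟨h, hv⟩
    refine hiff.2 ⟨S.Ttilde₁ ⟨u, h⟩, fun v => ?_⟩
    exact ((boundaryForm_eq_zero_iff_inner v _).1 (hv v)).symm

/-- The boundary form as the integral of a derivative. -/
theorem boundaryForm_eq_integral {u : S.T₁.domain} {v : S.Ttilde₁.domain} {w z : L2Space a b r}
    (hu : IsWeakDeriv a b (fun x => mact (S.A x) ((u : L2Space a b r) x)) w)
    (hv : IsWeakDeriv a b (fun x => mact (S.A x) ((v : L2Space a b r) x)) z) :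
    S.boundaryForm u v = ∫ x in Ioo a b, S.formalDeriv u w v z x := by
  rw [boundaryForm, scp, scp, T₁_apply u hu, Ttilde₁_apply v hv, L2.inner_def, L2.inner_def,
    ← integral_sub (L2.integrable_inner _ _) (L2.integrable_inner _ _)]
  refine integral_congr_ae ?_
  filter_upwards [Lp.coeFn_add w (S.mulB u), Lp.coeFn_add (-z) (S.mulAB v), Lp.coeFn_neg z,
    S.coeFn_mulB u, S.coeFn_mulAB v, S.isHermitian_A'] with x h1 h2 h3 h4 h5 h6
  -- The contributions of `B` cancel; of the zeroth order terms only `-A' u · v` remains.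
  rw [h1, h2, Pi.add_apply, Pi.add_apply, h3, h4, h5, Pi.neg_apply, formalDeriv, inner_add_right,
    inner_add_left, inner_neg_left, inner_mact_conjTranspose, Matrix.conjTranspose_conjTranspose,
    mact_add_left, inner_add_right, h6.inner_mact]
  ring

end FriedrichsCoeff

/-! ### Functional calculus and spectral variation for Hermitian matrices -/

/-- The operator on `ℂ^r` given by a matrix. -/
def matOp {r : ℕ} (M : Matrix (Fin r) (Fin r) ℂ) : Cvec r →L[ℂ] Cvec r :=
  Matrix.toEuclideanCLM (𝕜 := ℂ) M

section Spectral

variable {r : ℕ} {M N : Matrix (Fin r) (Fin r) ℂ}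

theorem matOp_apply (M : Matrix (Fin r) (Fin r) ℂ) (v : Cvec r) : matOp M v = mact M v := rfl

theorem matOp_sub (M N : Matrix (Fin r) (Fin r) ℂ) : matOp (M - N) = matOp M - matOp N :=
  map_sub (Matrix.toEuclideanCLM (𝕜 := ℂ)) M N

theorem spectrum_matOp (M : Matrix (Fin r) (Fin r) ℂ) : spectrum ℂ (matOp M) = spectrum ℂ M :=
  AlgEquiv.spectrum_eq (Matrix.toEuclideanCLM (𝕜 := ℂ) (n := Fin r)) M

theorem continuousOn_spectrum_matOp (M : Matrix (Fin r) (Fin r) ℂ) (f : ℂ → ℂ) :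
    ContinuousOn f (spectrum ℂ (matOp M)) := by
  rw [spectrum_matOp]
  exact (Matrix.finite_spectrum M).continuousOn f

theorem Matrix.IsHermitian.isSelfAdjoint_matOp (hM : M.IsHermitian) :
    IsSelfAdjoint (matOp M) := by
  rw [IsSelfAdjoint, matOp, ← map_star]
  congr 1

theorem Matrix.IsHermitian.isStarNormal_matOp (hM : M.IsHermitian) : IsStarNormal (matOp M) :=
  hM.isSelfAdjoint_matOp.isStarNormal

theorem Matrix.IsHermitian.conj_eq_of_mem_spectrum (hM : M.IsHermitian) {z : ℂ}
    (hz : z ∈ spectrum ℂ M) : starRingEnd ℂ z = z := by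
  rw [← spectrum_matOp] at hz
  rw [hM.isSelfAdjoint_matOp.mem_spectrum_eq_re hz, Complex.conj_ofReal]

theorem exists_eigenvector_of_mem_spectrum {μ : ℂ} (hμ : μ ∈ spectrum ℂ M) :
    ∃ v : Cvec r, v ≠ 0 ∧ matOp M v = μ • v := by
  have h : μ ∈ spectrum ℂ (Matrix.toLpLin 2 2 M) := by rwa [Matrix.spectrum_toLpLin]
  obtain ⟨v, hv⟩ := (Module.End.hasEigenvalue_iff_mem_spectrum.2 h).exists_hasEigenvector
  exact ⟨v, hv.2, hv.apply_eq_smul⟩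

theorem cfc_matOp_mul (f g : ℂ → ℂ) :
    cfc (fun z => f z * g z) (matOp M) = cfc f (matOp M) * cfc g (matOp M) :=
  cfc_mul f g _ (continuousOn_spectrum_matOp M f) (continuousOn_spectrum_matOp M g)

theorem Matrix.IsHermitian.cfc_mul_id (hM : M.IsHermitian) (f : ℂ → ℂ) :
    cfc (fun z => f z * z) (matOp M) = cfc f (matOp M) * matOp M := by
  have := hM.isStarNormal_matOp
  rw [cfc_matOp_mul, cfc_id' ℂ (matOp M)]

theorem Matrix.IsHermitian.cfc_id_mul (hM : M.IsHermitian) (f : ℂ → ℂ) :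
    cfc (fun z => z * f z) (matOp M) = matOp M * cfc f (matOp M) := by
  have := hM.isStarNormal_matOp
  rw [cfc_matOp_mul, cfc_id' ℂ (matOp M)]

/-- The functional calculus on eigenvectors. -/
theorem Matrix.IsHermitian.cfc_apply_of_eigenvector (hM : M.IsHermitian) (f : ℂ → ℂ) {μ : ℂ}
    {v : Cvec r} (hv : matOp M v = μ • v) : cfc f (matOp M) v = f μ • v := by
  have := hM.isStarNormal_matOp
  -- With this divided difference, `f z = f μ + g z * (z - μ)` for all `z`, also at `z = μ`, where
  -- the division by zero gives `0`. On `v` the factor `M - μ` vanishes.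
  set g : ℂ → ℂ := fun z => (f z - f μ) / (z - μ) with hg
  have h1 : cfc f (matOp M) = cfc (fun z => f μ + (g z * z - μ * g z)) (matOp M) := by
    refine cfc_congr fun z _ => ?_
    rcases eq_or_ne z μ with rfl | hz
    · simp [hg]
    · have : z - μ ≠ 0 := sub_ne_zero.2 hz
      simp only [hg]
      field_simp
      ring
  rw [h1, cfc_add _ _ _ (continuousOn_spectrum_matOp M _) (continuousOn_spectrum_matOp M _),
    cfc_sub _ _ _ (continuousOn_spectrum_matOp M _) (continuousOn_spectrum_matOp M _),
    hM.cfc_mul_id, cfc_const_mul _ _ _ (continuousOn_spectrum_matOp M _), cfc_const _ _]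
  simp only [_root_.add_apply, _root_.sub_apply, mul_apply_eq_comp, hv, map_smul,
    _root_.smul_apply, sub_self, add_zero, Algebra.algebraMap_eq_smul_one,
    one_apply_eq_self]

theorem inner_cfc_left (f : ℂ → ℂ) (v w : Cvec r) :
    inner ℂ (cfc f (matOp M) v) w = inner ℂ v (cfc (fun z => star (f z)) (matOp M) w) := by
  rw [cfc_star, ContinuousLinearMap.star_eq_adjoint, ContinuousLinearMap.adjoint_inner_right]

/-- The indicator of `μ` applied to `M` maps into the eigenspace, and `v` minus its image is
orthogonal to it; this characterises the orthogonal projection. -/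
theorem Matrix.IsHermitian.eigenProj_eq_cfc (hM : M.IsHermitian) (μ : ℂ) :
    eigenProj M μ = cfc (fun z => if z = μ then 1 else 0) (matOp M) := by
  ext1 v
  refine Submodule.eq_starProjection_of_mem_of_inner_eq_zero ?_ fun w hw => ?_
  · rw [Module.End.mem_eigenspace_iff]
    change (matOp M * cfc (fun z => if z = μ then 1 else 0) (matOp M)) v = _
    rw [← hM.cfc_id_mul, ← _root_.smul_apply,
      ← cfc_const_mul _ _ _ (continuousOn_spectrum_matOp M _)]
    congr 1
    refine cfc_congr fun z _ => ?_
    by_cases hz : z = μ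
    · simp [hz]
    · simp [hz]
  · have hw' : matOp M w = μ • w := Module.End.mem_eigenspace_iff.1 hw
    rw [inner_sub_left, inner_cfc_left, hM.cfc_apply_of_eigenvector _ hw']
    simp

theorem Matrix.IsHermitian.totalProj_eq_cfc (hM : M.IsHermitian) (l : ℂ) (ρ : ℝ) :
    totalProj M l ρ = cfc (fun z => if ‖z - l‖ < ρ then 1 else 0) (matOp M) := by
  rw [totalProj, Finset.sum_congr rfl fun μ _ => hM.eigenProj_eq_cfc μ,
    ← cfc_sum _ _ _ fun μ _ => continuousOn_spectrum_matOp M _]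
  refine cfc_congr fun z hz => ?_
  rw [spectrum_matOp] at hz
  simp only [Finset.sum_apply, Finset.sum_ite_eq, Set.Finite.mem_toFinset, mem_inter_iff, hz,
    true_and, mem_ball_iff_norm]

theorem opNorm_matOp_le (M : Matrix (Fin r) (Fin r) ℂ) : ‖matOp M‖ ≤ ∑ i, ∑ j, ‖M i j‖ := by
  refine ContinuousLinearMap.opNorm_le_bound _ (by positivity) fun v => ?_
  have h1 : mact M v = ∑ i, EuclideanSpace.single i (mact M v i) := by
    ext j
    simp [Pi.single_apply]
  rw [matOp_apply, h1]
  refine (norm_sum_le _ _).trans ?_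
  rw [Finset.sum_mul]
  refine Finset.sum_le_sum fun i _ => ?_
  rw [PiLp.norm_single, mact_apply, Finset.sum_mul]
  refine (norm_sum_le _ _).trans (Finset.sum_le_sum fun j _ => ?_)
  rw [norm_mul]
  gcongr
  exact PiLp.norm_apply_le v j

/-- Spectral variation: an eigenvalue of `N` at distance at least `κ` from the spectrum of the
Hermitian matrix `M` forces `κ ≤ ‖M - N‖`. -/
theorem Matrix.IsHermitian.le_norm_sub_of_mem_spectrum (hM : M.IsHermitian) {μ : ℂ}
    (hμ : μ ∈ spectrum ℂ N) {κ : ℝ} (hκ : 0 < κ) (h : ∀ ν ∈ spectrum ℂ M, κ ≤ ‖ν - μ‖) :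
    κ ≤ ‖matOp M - matOp N‖ := by
  have := hM.isStarNormal_matOp
  obtain ⟨v, hv0, hv⟩ := exists_eigenvector_of_mem_spectrum hμ
  -- The function `(z - μ)⁻¹` yields the resolvent `R` of `M`. For an eigenvector `v` of `N` one has
  -- `(M - μ) v = (M - N) v`, so `R (M - N) v = v`, while `‖R‖ ≤ κ⁻¹`.
  have h1 : cfc (fun z => (z - μ)⁻¹ * z - μ * (z - μ)⁻¹) (matOp M) = 1 := by
    rw [← cfc_const_one ℂ (matOp M)]
    refine cfc_congr fun z hz => ?_
    rw [spectrum_matOp] at hz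
    have : z - μ ≠ 0 := norm_pos_iff.1 (hκ.trans_le (h z hz))
    field_simp
  rw [cfc_sub _ _ _ (continuousOn_spectrum_matOp M _) (continuousOn_spectrum_matOp M _),
    hM.cfc_mul_id, cfc_const_mul _ _ _ (continuousOn_spectrum_matOp M _)] at h1
  set R := cfc (fun z => (z - μ)⁻¹) (matOp M) with hR
  have h2 : R ((matOp M - matOp N) v) = v := by
    have h3 : (R * matOp M - μ • R) v = v := by rw [h1]; rfl
    rw [_root_.sub_apply, map_sub, hv, map_smul]
    simpa using h3
  have hRn : ‖R‖ ≤ κ⁻¹ := by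
    refine norm_cfc_le (by positivity) fun z hz => ?_
    rw [spectrum_matOp] at hz
    rw [norm_inv]
    exact inv_anti₀ hκ (h z hz)
  have hvn : 0 < ‖v‖ := norm_pos_iff.2 hv0
  have h4 : ‖v‖ ≤ κ⁻¹ * (‖matOp M - matOp N‖ * ‖v‖) := by
    calc ‖v‖ = ‖R ((matOp M - matOp N) v)‖ := by rw [h2]
      _ ≤ ‖R‖ * ‖(matOp M - matOp N) v‖ := R.le_opNorm _
      _ ≤ κ⁻¹ * (‖matOp M - matOp N‖ * ‖v‖) := by
        gcongr
        exact ContinuousLinearMap.le_opNorm _ _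
  rw [← mul_assoc] at h4
  have h5 : 1 ≤ κ⁻¹ * ‖matOp M - matOp N‖ := by
    by_contra hlt
    push Not at hlt
    nlinarith
  rwa [inv_mul_eq_div, le_div_iff₀ hκ, one_mul] at h5

/-- A continuous function on `ℂ` which equals `t⁻¹` for `|t| ≥ c`. -/
def truncInv (c : ℝ) (t : ℂ) : ℂ := starRingEnd ℂ t / ((max ‖t‖ c : ℝ) : ℂ) ^ 2

theorem continuous_truncInv {c : ℝ} (hc : 0 < c) : Continuous (truncInv c) := by
  refine Continuous.div Complex.continuous_conj (by fun_prop) fun t => ?_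
  exact pow_ne_zero _ (Complex.ofReal_ne_zero.2 (lt_max_of_lt_right hc).ne')

theorem truncInv_of_le {c : ℝ} (hc : 0 < c) {t : ℂ} (ht : c ≤ ‖t‖) : truncInv c t = t⁻¹ := by
  have h0 : t ≠ 0 := norm_pos_iff.1 (hc.trans_le ht)
  have h1 : starRingEnd ℂ t * t = (‖t‖ : ℂ) ^ 2 := Complex.conj_mul' t
  have h2 : (‖t‖ : ℂ) ≠ 0 := Complex.ofReal_ne_zero.2 (norm_ne_zero_iff.2 h0)
  rw [truncInv, max_eq_left ht, div_eq_iff (pow_ne_zero _ h2), ← h1]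
  field_simp

theorem truncInv_zero (c : ℝ) : truncInv c 0 = 0 := by simp [truncInv]

/-- For `|t| < c` the product `t * truncInv c t` is the real number `|t|² / c²` in `[0, 1]`, so `t`
is only multiplied by a factor in `[0, 1]`; for `|t| ≥ c` the expression is zero. -/
theorem norm_sub_truncInv_le {c : ℝ} (hc : 0 < c) (t : ℂ) :
    ‖t - t * truncInv c t * t‖ ≤ ‖t‖ := by
  rcases le_or_gt c ‖t‖ with h | h
  · have h0 : t ≠ 0 := norm_pos_iff.1 (hc.trans_le h)
    rw [truncInv_of_le hc h, mul_inv_cancel₀ h0, one_mul, sub_self, norm_zero]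
    exact norm_nonneg t
  · have h1 : t * truncInv c t = ((‖t‖ ^ 2 / c ^ 2 : ℝ) : ℂ) := by
      rw [truncInv, max_eq_right h.le, mul_div_assoc', Complex.mul_conj']
      push_cast
      rfl
    have h2 : ‖t‖ ^ 2 / c ^ 2 ≤ 1 := by
      rw [div_le_one (by positivity)]
      gcongr
    have h3 : t - t * truncInv c t * t = ((1 - ‖t‖ ^ 2 / c ^ 2 : ℝ) : ℂ) * t := by
      rw [h1]
      push_cast
      ring
    rw [h3, norm_mul, Complex.norm_real, Real.norm_of_nonneg (by linarith)]
    have h4 : 0 ≤ ‖t‖ ^ 2 / c ^ 2 := by positivity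
    have := norm_nonneg t
    nlinarith

theorem sub_truncInv_eq_zero {c : ℝ} (hc : 0 < c) {t : ℂ} (h : c ≤ ‖t‖) :
    t - t * truncInv c t * t = 0 := by
  have h0 : t ≠ 0 := norm_pos_iff.1 (hc.trans_le h)
  rw [truncInv_of_le hc h, mul_inv_cancel₀ h0, one_mul, sub_self]

/-- Only eigenvalues `t` of `N` with `|t| < c` contribute, each at most `|t|`. The nonzero
eigenvalues of `M` have modulus at least `2 * c`, so such a `t` has distance at least `|t|` from the
spectrum of `M`, and spectral variation gives `|t| ≤ ‖M - N‖`. -/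
theorem Matrix.IsHermitian.norm_sub_cfc_truncInv_le (hM : M.IsHermitian) (hN : N.IsHermitian)
    {c : ℝ} (hc : 0 < c) (h : ∀ ν ∈ spectrum ℂ M, ν ≠ 0 → 2 * c ≤ ‖ν‖) :
    ‖matOp N - matOp N * cfc (truncInv c) (matOp N) * matOp N‖ ≤ ‖matOp M - matOp N‖ := by
  have := hN.isStarNormal_matOp
  have h1 : matOp N - matOp N * cfc (truncInv c) (matOp N) * matOp N
      = cfc (fun t => t - t * truncInv c t * t) (matOp N) := by
    rw [cfc_sub _ _ _ (continuousOn_spectrum_matOp N _) (continuousOn_spectrum_matOp N _),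
      cfc_id' ℂ (matOp N), hN.cfc_mul_id, hN.cfc_id_mul]
  rw [h1]
  refine norm_cfc_le (norm_nonneg _) fun t ht => ?_
  rw [spectrum_matOp] at ht
  rcases le_or_gt c ‖t‖ with hct | hct
  · rw [sub_truncInv_eq_zero hc hct, norm_zero]
    exact norm_nonneg _
  · refine (norm_sub_truncInv_le hc t).trans ?_
    rcases eq_or_ne t 0 with rfl | ht0
    · rw [norm_zero]; exact norm_nonneg _
    · refine hM.le_norm_sub_of_mem_spectrum ht (norm_pos_iff.2 ht0) fun ν hν => ?_
      rcases eq_or_ne ν 0 with rfl | hν0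
      · simp
      · have h2 := h ν hν hν0
        have h3 := norm_sub_norm_le ν t
        linarith

theorem exists_gap_zero (M : Matrix (Fin r) (Fin r) ℂ) :
    ∃ c : ℝ, 0 < c ∧ ∀ ν ∈ spectrum ℂ M, ν ≠ 0 → 2 * c ≤ ‖ν‖ := by
  have hf : (spectrum ℂ M \ {0}).Finite := (Matrix.finite_spectrum M).subset sdiff_subset
  have h0 : (spectrum ℂ M \ {0})ᶜ ∈ 𝓝 (0 : ℂ) := hf.isClosed.isOpen_compl.mem_nhds (by simp)
  obtain ⟨ε, hε, hsub⟩ := Metric.mem_nhds_iff.1 h0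
  refine ⟨ε / 2, by linarith, fun ν hν hν0 => ?_⟩
  by_contra hlt
  push Not at hlt
  refine hsub (a := ν) ?_ ⟨hν, hν0⟩
  rw [mem_ball_zero_iff]
  linarith

/-- The margin `3 * δ` leaves room for a cut-off that descends between radii `δ` and `2 * δ` about
`l`, avoids the other eigenvalues, and keeps distance `δ` from `0`. -/
theorem exists_gap (M : Matrix (Fin r) (Fin r) ℂ) {l : ℂ} (hl : l ≠ 0) :
    ∃ δ : ℝ, 0 < δ ∧ 3 * δ ≤ ‖l‖ ∧ ∀ ν ∈ spectrum ℂ M, ν ≠ l → 3 * δ ≤ ‖ν - l‖ := by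
  have hf : (spectrum ℂ M \ {l}).Finite := (Matrix.finite_spectrum M).subset sdiff_subset
  have h0 : (spectrum ℂ M \ {l})ᶜ ∈ 𝓝 l := hf.isClosed.isOpen_compl.mem_nhds (by simp)
  obtain ⟨ε, hε, hsub⟩ := Metric.mem_nhds_iff.1 h0
  have hl' := norm_pos_iff.2 hl
  refine ⟨min (ε / 3) (‖l‖ / 3), lt_min (by linarith) (by linarith), ?_, fun ν hν hν0 => ?_⟩
  · linarith [min_le_right (ε / 3) (‖l‖ / 3)]
  · by_contra hlt
    push Not at hlt
    refine hsub (a := ν) ?_ ⟨hν, hν0⟩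
    rw [mem_ball_iff_norm]
    linarith [min_le_left (ε / 3) (‖l‖ / 3)]

/-- A continuous cut-off which is `1` on the disc of radius `δ` about `l` and `0` off the disc of
radius `2 δ`. -/
def tent (l : ℂ) (δ : ℝ) (t : ℂ) : ℂ := ((max 0 (min 1 (2 - ‖t - l‖ / δ)) : ℝ) : ℂ)

theorem continuous_tent (l : ℂ) (δ : ℝ) : Continuous (tent l δ) := by
  unfold tent
  fun_prop

theorem tent_of_le {l : ℂ} {δ : ℝ} (hδ : 0 < δ) {t : ℂ} (h : ‖t - l‖ ≤ δ) : tent l δ t = 1 := by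
  have : ‖t - l‖ / δ ≤ 1 := (div_le_one hδ).2 h
  rw [tent, min_eq_left (by linarith), max_eq_right zero_le_one, Complex.ofReal_one]

theorem tent_of_ge {l : ℂ} {δ : ℝ} (hδ : 0 < δ) {t : ℂ} (h : 2 * δ ≤ ‖t - l‖) :
    tent l δ t = 0 := by
  have : 2 ≤ ‖t - l‖ / δ := (le_div_iff₀ hδ).2 h
  rw [tent, max_eq_left ((min_le_right _ _).trans (by linarith)), Complex.ofReal_zero]

theorem tent_mul_truncInv_mul {l : ℂ} {δ : ℝ} (hδ : 0 < δ) (hl : 3 * δ ≤ ‖l‖) (t : ℂ) :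
    tent l δ t * truncInv δ t * t = tent l δ t := by
  rcases le_or_gt (2 * δ) ‖t - l‖ with h | h
  · rw [tent_of_ge hδ h, zero_mul, zero_mul]
  · have h1 : δ ≤ ‖t‖ := by
      have := norm_sub_norm_le l t
      rw [norm_sub_rev] at this
      linarith
    have h0 : t ≠ 0 := norm_pos_iff.1 (hδ.trans_le h1)
    rw [truncInv_of_le hδ h1, inv_mul_cancel_right₀ h0]

/-- The total projection agrees with the cut-off near a matrix for which the circle isolates `l`. -/
theorem exists_totalProj_eq_cfc_tent (hM : M.IsHermitian) {l : ℂ} {δ ρ : ℝ} (hδ : 0 < δ)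
    (hgap : ∀ ν ∈ spectrum ℂ M, ν ≠ l → 3 * δ ≤ ‖ν - l‖) (hρ : IsolatesEigenvalue M l ρ) :
    ∃ κ : ℝ, 0 < κ ∧ ∀ N : Matrix (Fin r) (Fin r) ℂ, N.IsHermitian → ‖matOp M - matOp N‖ < κ →
      totalProj N l ρ = cfc (tent l δ) (matOp N) := by
  -- On `U` the indicator of the disc and the cut-off agree. It is an open neighbourhood of the
  -- spectrum of `M`, hence contains the spectrum of every Hermitian `N` close to `M`.
  let U : Set ℂ := {t | ‖t - l‖ < min δ ρ} ∪ {t | max ρ (2 * δ) < ‖t - l‖}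
  have hU : IsOpen U := (isOpen_lt (by fun_prop) continuous_const).union
    (isOpen_lt continuous_const (by fun_prop))
  have hsub : spectrum ℂ M ⊆ U := by
    intro ν hν
    rcases eq_or_ne ν l with rfl | h
    · left
      simp [hδ, hρ.1]
    · right
      change max ρ (2 * δ) < ‖ν - l‖
      refine max_lt ?_ (by linarith [hgap ν hν h])
      by_contra hle
      have hmem : ν ∈ spectrum ℂ M ∩ Metric.closedBall l ρ :=
        ⟨hν, mem_closedBall_iff_norm.2 (not_lt.1 hle)⟩
      rw [hρ.2] at hmem
      exact h hmem
  obtain ⟨κ, hκ, hthick⟩ := (Matrix.finite_spectrum M).isCompact.exists_thickening_subset_open hU hsub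
  refine ⟨κ, hκ, fun N hN hlt => ?_⟩
  rw [hN.totalProj_eq_cfc]
  refine cfc_congr fun t ht => ?_
  rw [spectrum_matOp] at ht
  have htU : t ∈ U := by
    by_contra htU
    refine (hM.le_norm_sub_of_mem_spectrum ht hκ fun ν hν => ?_).not_gt hlt
    by_contra hlt'
    refine htU (hthick (Metric.mem_thickening_iff.2 ⟨ν, hν, ?_⟩))
    rw [dist_eq_norm, norm_sub_rev]
    exact not_le.1 hlt'
  rcases htU with h | h
  · have h' : ‖t - l‖ < min δ ρ := h
    simp only [if_pos (h'.trans_le (min_le_right _ _))]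
    rw [tent_of_le hδ (h'.le.trans (min_le_left _ _))]
  · have h' : max ρ (2 * δ) < ‖t - l‖ := h
    simp only [if_neg (not_lt.2 ((le_max_left _ _).trans h'.le))]
    rw [tent_of_ge hδ ((le_max_right _ _).trans h'.le)]

end Spectral

/-! ### Boundary values of `A u · v` and of `P_l u` -/

theorem exists_Ioo_near {a b x₀ ε : ℝ} (hab : a < b) (hx₀ : x₀ ∈ Icc a b) (hε : 0 < ε) :
    max a (x₀ - ε) < min b (x₀ + ε) ∧ x₀ ∈ Icc (max a (x₀ - ε)) (min b (x₀ + ε)) := by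
  refine ⟨?_, ?_, ?_⟩
  · rw [max_lt_iff, lt_min_iff, lt_min_iff]
    exact ⟨⟨hab, by linarith [hx₀.1]⟩, by linarith [hx₀.2], by linarith⟩
  · exact max_le hx₀.1 (by linarith)
  · exact le_min hx₀.2 (by linarith)

/-- A continuous function bounded by `|x - x₀|` times an integrable function vanishes at `x₀`. -/
theorem eq_zero_of_norm_le_abs_mul {a b x₀ : ℝ} (hab : a < b) (hx₀ : x₀ ∈ Icc a b) {R : ℝ → ℂ}
    {g : ℝ → ℝ} (hR : ContinuousOn R (Icc a b)) (hg : IntegrableOn g (Ioo a b))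
    (h : ∀ᵐ x ∂(intervalMeasure a b), ‖R x‖ ≤ |x - x₀| * g x) : R x₀ = 0 := by
  by_contra h0
  have hδ : 0 < ‖R x₀‖ / 2 := half_pos (norm_pos_iff.2 h0)
  set δ := ‖R x₀‖ / 2 with hδdef
  obtain ⟨ε, hε, hnear⟩ := Metric.continuousWithinAt_iff.1 (hR x₀ hx₀) δ hδ
  obtain ⟨hlt, hmem⟩ := exists_Ioo_near hab hx₀ hε
  have hsub : Ioo (max a (x₀ - ε)) (min b (x₀ + ε)) ⊆ Ioo a b :=
    Ioo_subset_Ioo (le_max_left _ _) (min_le_left _ _)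
  -- If `R x₀ ≠ 0`, then `|R| ≥ δ` near `x₀`, so `|x - x₀|⁻¹ ≤ δ⁻¹ g`; this would make `(x - x₀)⁻¹`
  -- integrable on an interval whose closure contains `x₀`.
  have hint : IntegrableOn (fun x => (x - x₀)⁻¹) (Ioo (max a (x₀ - ε)) (min b (x₀ + ε))) := by
    refine ((hg.mono_set hsub).const_mul δ⁻¹).mono' (by fun_prop) ?_
    have h' := ae_mono (Measure.restrict_mono hsub le_rfl) h
    filter_upwards [h', ae_restrict_mem measurableSet_Ioo] with x hx hxI
    have hd : dist x x₀ < ε := by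
      rw [Real.dist_eq, abs_lt]
      have h1 := (le_max_right a (x₀ - ε)).trans_lt hxI.1
      have h2 := hxI.2.trans_le (min_le_right b (x₀ + ε))
      constructor <;> linarith
    have h1 := hnear (Ioo_subset_Icc_self (hsub hxI)) hd
    rw [dist_eq_norm, norm_sub_rev] at h1
    have h2 : δ ≤ ‖R x‖ := by
      have := norm_sub_norm_le (R x₀) (R x)
      linarith
    have h3 : 0 < |x - x₀| * g x := hδ.trans_le (h2.trans hx)
    have h4 : 0 < |x - x₀| := by
      rcases (abs_nonneg (x - x₀)).eq_or_lt with h5 | h5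
      · rw [← h5, zero_mul] at h3; exact absurd h3 (lt_irrefl _)
      · exact h5
    rw [norm_inv, Real.norm_eq_abs, inv_eq_one_div, div_le_iff₀ h4, mul_assoc,
      ← div_eq_inv_mul, le_div_iff₀ hδ, one_mul, mul_comm (g x)]
    exact h2.trans hx
  have hii : IntervalIntegrable (fun x => (x - x₀)⁻¹) volume (max a (x₀ - ε)) (min b (x₀ + ε)) :=
    (intervalIntegrable_iff_integrableOn_Ioo_of_le hlt.le).2 hint
  rcases intervalIntegrable_sub_inv_iff.1 hii with h1 | h1
  · exact hlt.ne h1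
  · exact h1 (by rwa [uIcc_of_le hlt.le])

namespace FriedrichsCoeff

variable {a b : ℝ} {r : ℕ} {S : FriedrichsCoeff a b r}

theorem exists_lipschitz_A (hab : a < b) (S : FriedrichsCoeff a b r) :
    ∃ L : ℝ, 0 ≤ L ∧ ∀ x ∈ Icc a b, ∀ y ∈ Icc a b,
      ‖matOp (S.A y) - matOp (S.A x)‖ ≤ L * |y - x| := by
  have h : ∀ i j, ∃ C : ℝ, 0 ≤ C ∧ ∀ x ∈ Icc a b, ∀ y ∈ Icc a b,
      ‖S.A y i j - S.A x i j‖ ≤ C * |y - x| := by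
    intro i j
    have hlt : eLpNormEssSup (fun x => S.A' x i j) (intervalMeasure a b) < ∞ := by
      simpa using (S.memLp_A' i j).2
    refine ⟨(eLpNormEssSup (fun x => S.A' x i j) (intervalMeasure a b)).toReal,
      ENNReal.toReal_nonneg, fun x hx y hy => ?_⟩
    rw [A_sub hab i j x hx y hy]
    refine intervalIntegral.norm_integral_le_of_norm_le_const_ae ?_
    have hae := ae_le_eLpNormEssSup (f := fun x => S.A' x i j) (μ := intervalMeasure a b)
    rw [intervalMeasure, Measure.restrict_congr_set Ioo_ae_eq_Ioc,
      ae_restrict_iff' measurableSet_Ioc] at hae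
    filter_upwards [hae] with t ht htI
    have htI' : t ∈ Ioc a b := by
      rw [uIoc, mem_Ioc] at htI
      exact ⟨(le_min hx.1 hy.1).trans_lt htI.1, htI.2.trans (max_le hx.2 hy.2)⟩
    rw [← toReal_enorm]
    refine ENNReal.toReal_mono hlt.ne ((ht htI').trans_eq ?_)
    rw [intervalMeasure, Measure.restrict_congr_set Ioo_ae_eq_Ioc]
  choose C hC0 hC using h
  refine ⟨∑ i, ∑ j, C i j, Finset.sum_nonneg fun i _ => Finset.sum_nonneg fun j _ => hC0 i j,
    fun x hx y hy => ?_⟩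
  rw [← matOp_sub]
  refine (opNorm_matOp_le _).trans ?_
  rw [Finset.sum_mul]
  refine Finset.sum_le_sum fun i _ => ?_
  rw [Finset.sum_mul]
  exact Finset.sum_le_sum fun j _ => hC i j x hx y hy

theorem continuousOn_matOp_A (hab : a < b) (S : FriedrichsCoeff a b r) :
    ContinuousOn (fun x => matOp (S.A x)) (Icc a b) := by
  obtain ⟨L, hL, h⟩ := exists_lipschitz_A hab S
  refine LipschitzOnWith.continuousOn (K := ⟨L, hL⟩) (LipschitzOnWith.of_dist_le_mul ?_)
  intro y hy x hx
  rw [dist_eq_norm, Real.dist_eq]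
  exact h x hx y hy

theorem continuousOn_cfc_A (hab : a < b) (S : FriedrichsCoeff a b r) {f : ℂ → ℂ}
    (hf : Continuous f) : ContinuousOn (fun x => cfc f (matOp (S.A x))) (Icc a b) :=
  ContinuousOn.cfc_of_mem_nhdsSet (s := univ) f univ_mem (continuousOn_matOp_A hab S)
    (fun x hx => (isHermitian_A hab x hx).isStarNormal_matOp) hf.continuousOn

/-- The boundary value of the function `A u · v`. -/
theorem IsFlux.boundary_value (hab : a < b) {u w v z : L2Space a b r} {p q : ℝ → Cvec r}
    (hu : S.IsFlux u w p) (hv : S.IsFlux v z q) {H : ℝ → ℂ} (hH : ContinuousOn H (Icc a b))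
    (hHae : ∀ᵐ x ∂(intervalMeasure a b), H x = inner ℂ (v x) (p x)) {x₀ : ℝ} (hx₀ : x₀ ∈ Icc a b)
    {c : ℝ} (hc : 0 < c) (hgap : ∀ ν ∈ spectrum ℂ (S.A x₀), ν ≠ 0 → 2 * c ≤ ‖ν‖) :
    H x₀ = inner ℂ (q x₀) (cfc (truncInv c) (matOp (S.A x₀)) (p x₀)) := by
  obtain ⟨L, hL, hLip⟩ := exists_lipschitz_A hab S
  rw [← sub_eq_zero]
  refine eq_zero_of_norm_le_abs_mul hab hx₀
    (R := fun x => H x - inner ℂ (q x) (cfc (truncInv c) (matOp (S.A x)) (p x)))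
    (g := fun x => L * (‖v x‖ * ‖u x‖)) ?_ ?_ ?_
  · exact hH.sub (hv.continuous.continuousOn.inner
      ((continuousOn_cfc_A hab S (continuous_truncInv hc)).clm_apply hu.continuous.continuousOn))
  · exact ((Lp.memLp v).norm.integrable_mul (Lp.memLp u).norm).const_mul L
  · filter_upwards [hHae, hu.ae_eq, hv.ae_eq, ae_restrict_mem measurableSet_Ioo] with x h1 h2 h3 hx
    have hxI := Ioo_subset_Icc_self hx
    have hA := S.hermitian_A x hx
    -- Inserting `p = A u` and `q = A v` leaves the defect of `truncInv c` as a pseudo-inverse of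
    -- `A`.
    have e : H x - inner ℂ (q x) (cfc (truncInv c) (matOp (S.A x)) (p x))
        = inner ℂ (v x) ((matOp (S.A x) - matOp (S.A x) * cfc (truncInv c) (matOp (S.A x))
          * matOp (S.A x)) (u x)) := by
      rw [h1, h3, h2, hA.inner_mact, ← inner_sub_right]
      rfl
    rw [e]
    calc _ ≤ ‖v x‖ * ‖(matOp (S.A x) - matOp (S.A x) * cfc (truncInv c) (matOp (S.A x))
          * matOp (S.A x)) (u x)‖ := norm_inner_le_norm _ _
      _ ≤ ‖v x‖ * (L * |x - x₀| * ‖u x‖) := by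
        gcongr
        refine (ContinuousLinearMap.le_opNorm _ _).trans ?_
        gcongr
        refine ((isHermitian_A hab x₀ hx₀).norm_sub_cfc_truncInv_le hA hc hgap).trans ?_
        rw [abs_sub_comm]
        exact hLip x hxI x₀ hx₀
      _ = |x - x₀| * (L * (‖v x‖ * ‖u x‖)) := by ring

theorem mem_nonzeroEigenvalues {M : Matrix (Fin r) (Fin r) ℂ} {l : ℂ} :
    l ∈ nonzeroEigenvalues M ↔ l ∈ spectrum ℂ M ∧ l ≠ 0 := by
  simp [nonzeroEigenvalues]

/-- Near `x₀` the total projection is `tent(A)`, and `tent t = tent t * truncInv t * t`. So `P_l u`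
is a continuous function of `A(x)` applied to `A u = p`. On the spectrum of `A(x₀)` that function is
`l⁻¹` at `l` and zero elsewhere. -/
theorem IsFlux.isProjValue (hab : a < b) {u w : L2Space a b r} {p : ℝ → Cvec r}
    (hu : S.IsFlux u w p) {x₀ : ℝ} (hx₀ : x₀ ∈ Icc a b) {l : ℂ}
    (hl : l ∈ nonzeroEigenvalues (S.A x₀)) :
    S.IsProjValue u x₀ l (cfc (fun z => if z = l then l⁻¹ else 0) (matOp (S.A x₀)) (p x₀)) := by
  rw [mem_nonzeroEigenvalues] at hl
  obtain ⟨δ, hδ, hδl, hgap⟩ := exists_gap (S.A x₀) hl.2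
  intro ρ hρ
  obtain ⟨κ, hκ, htot⟩ := exists_totalProj_eq_cfc_tent (isHermitian_A hab x₀ hx₀) hδ hgap hρ
  obtain ⟨ε, hε, hnear⟩ := Metric.continuousWithinAt_iff.1 (continuousOn_matOp_A hab S x₀ hx₀) κ hκ
  refine ⟨ε / 2, half_pos hε,
    fun x => cfc (fun t => tent l δ t * truncInv δ t) (matOp (S.A x)) (p x), ?_, ?_, ?_⟩
  · refine ContinuousOn.mono ?_ inter_subset_left
    exact (continuousOn_cfc_A hab S ((continuous_tent l δ).mul (continuous_truncInv hδ))).clm_apply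
      hu.continuous.continuousOn
  · have h1 := ae_mono (Measure.restrict_mono (μ := volume)
      (inter_subset_left (s := Ioo a b) (t := Icc (x₀ - ε / 2) (x₀ + ε / 2))) le_rfl) hu.ae_eq
    filter_upwards [h1, ae_restrict_mem (measurableSet_Ioo.inter measurableSet_Icc)] with x hx hxI
    have hd : dist x x₀ < ε := by
      rw [Real.dist_eq, abs_lt]
      constructor <;> linarith [hxI.2.1, hxI.2.2]
    have hlt := hnear (Ioo_subset_Icc_self hxI.1) hd
    rw [dist_eq_norm, norm_sub_rev] at hlt
    have hA := S.hermitian_A x hxI.1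
    rw [htot _ hA hlt, hx]
    change (cfc (fun t => tent l δ t * truncInv δ t) (matOp (S.A x)) * matOp (S.A x)) (u x) = _
    rw [← hA.cfc_mul_id]
    congr 2
    funext t
    exact tent_mul_truncInv_mul hδ hδl t
  · simp only
    congr 1
    refine cfc_congr fun t ht => ?_
    rw [spectrum_matOp] at ht
    by_cases h : t = l
    · subst h
      simp only [if_true]
      rw [tent_of_le hδ (by simpa using hδ.le), truncInv_of_le hδ (by linarith), one_mul]
    · simp only [if_neg h]
      rw [tent_of_ge hδ (by linarith [hgap t ht h]), zero_mul]

/-- The defining condition quantifies over isolating circles, so one must exist; radius `δ` from the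
spectral gap serves. Two continuous representatives then agree on an interval containing `x₀`. -/
theorem IsProjValue.unique (hab : a < b) {u : L2Space a b r} {x₀ : ℝ} (hx₀ : x₀ ∈ Icc a b) {l : ℂ}
    (hl : l ∈ nonzeroEigenvalues (S.A x₀)) {w w' : Cvec r} (h : S.IsProjValue u x₀ l w)
    (h' : S.IsProjValue u x₀ l w') : w = w' := by
  rw [mem_nonzeroEigenvalues] at hl
  obtain ⟨δ, hδ, hδl, hgap⟩ := exists_gap (S.A x₀) hl.2
  have hiso : IsolatesEigenvalue (S.A x₀) l δ := by
    refine ⟨hδ, Subset.antisymm (fun ν hν => ?_) ?_⟩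
    · by_contra hne
      have h1 := hgap ν hν.1 hne
      have h2 := mem_closedBall_iff_norm.1 hν.2
      linarith
    · rintro _ rfl
      exact ⟨hl.1, Metric.mem_closedBall_self hδ.le⟩
  obtain ⟨ε, hε, g, hg, hgae, rfl⟩ := h δ hiso
  obtain ⟨ε', hε', g', hg', hgae', rfl⟩ := h' δ hiso
  obtain ⟨hlt, hmem⟩ := exists_Ioo_near hab hx₀ (lt_min hε hε')
  have hsub : ∀ {η : ℝ}, min ε ε' ≤ η → Icc (max a (x₀ - min ε ε')) (min b (x₀ + min ε ε'))
      ⊆ Icc a b ∩ Icc (x₀ - η) (x₀ + η) := by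
    intro η hη x hx
    rw [mem_Icc, max_le_iff, le_min_iff] at hx
    exact ⟨⟨hx.1.1, hx.2.1⟩, by linarith [hx.1.2], by linarith [hx.2.2]⟩
  have hsub' : ∀ {η : ℝ}, min ε ε' ≤ η → Ioo (max a (x₀ - min ε ε')) (min b (x₀ + min ε ε'))
      ⊆ Ioo a b ∩ Icc (x₀ - η) (x₀ + η) := by
    intro η hη x hx
    exact ⟨⟨(le_max_left _ _).trans_lt hx.1, hx.2.trans_le (min_le_left _ _)⟩,
      (hsub hη (Ioo_subset_Icc_self hx)).2⟩
  refine eqOn_Icc_of_ae_eq hlt (hg.mono (hsub (min_le_left _ _)))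
    (hg'.mono (hsub (min_le_right _ _))) ?_ hmem
  filter_upwards [ae_mono (Measure.restrict_mono (hsub' (min_le_left ε ε')) le_rfl) hgae,
    ae_mono (Measure.restrict_mono (hsub' (min_le_right ε ε')) le_rfl) hgae'] with x h1 h2
  rw [h1, h2]

theorem IsFlux.projValue_eq (hab : a < b) {u w : L2Space a b r} {p : ℝ → Cvec r}
    (hu : S.IsFlux u w p) {x₀ : ℝ} (hx₀ : x₀ ∈ Icc a b) {l : ℂ}
    (hl : l ∈ nonzeroEigenvalues (S.A x₀)) :
    S.projValue u x₀ l = cfc (fun z => if z = l then l⁻¹ else 0) (matOp (S.A x₀)) (p x₀) :=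
  (Classical.epsilon_spec (p := S.IsProjValue u x₀ l) ⟨_, hu.isProjValue hab hx₀ hl⟩).unique
    hab hx₀ hl (hu.isProjValue hab hx₀ hl)

/-- The sum over the nonzero eigenvalues in terms of the functional calculus. -/
theorem sum_projValue_eq (hab : a < b) {u w v z : L2Space a b r} {p q : ℝ → Cvec r}
    (hu : S.IsFlux u w p) (hv : S.IsFlux v z q) {x₀ : ℝ} (hx₀ : x₀ ∈ Icc a b) {c : ℝ} (hc : 0 < c)
    (hgap : ∀ ν ∈ spectrum ℂ (S.A x₀), ν ≠ 0 → 2 * c ≤ ‖ν‖) :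
    ∑ l ∈ nonzeroEigenvalues (S.A x₀), l * scp (S.projValue u x₀ l) (S.projValue v x₀ l)
      = inner ℂ (q x₀) (cfc (truncInv c) (matOp (S.A x₀)) (p x₀)) := by
  have hA := isHermitian_A (S := S) hab x₀ hx₀
  have h1 : ∀ l ∈ nonzeroEigenvalues (S.A x₀),
      l * scp (S.projValue u x₀ l) (S.projValue v x₀ l) = inner ℂ (q x₀)
        (cfc (fun t => if t = l then l⁻¹ else 0) (matOp (S.A x₀)) (p x₀)) := by
    intro l hl
    have hl' := mem_nonzeroEigenvalues.1 hl
    have hconj := hA.conj_eq_of_mem_spectrum hl'.1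
    -- As `l` is real, moving the projection off `q` gives `l * l⁻¹ * l⁻¹ = l⁻¹` on the eigenspace.
    -- Summed over `l`, these functions coincide with `truncInv c` on the spectrum.
    rw [hu.projValue_eq hab hx₀ hl, hv.projValue_eq hab hx₀ hl, scp, inner_cfc_left,
      ← inner_smul_right, ← _root_.smul_apply, ← mul_apply_eq_comp, smul_mul_assoc,
      ← cfc_matOp_mul, ← cfc_const_mul _ _ _ (continuousOn_spectrum_matOp _ _)] 
    congr 2
    refine cfc_congr fun t _ => ?_
    by_cases h : t = l
    · have h0 := hl'.2
      simp only [if_pos h, star_inv₀, RCLike.star_def, hconj]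
      field_simp
    · simp only [if_neg h, star_zero, mul_zero]
  rw [Finset.sum_congr rfl h1, ← inner_sum, ← sum_apply,
    ← cfc_sum _ _ _ fun l _ => continuousOn_spectrum_matOp _ _]
  congr 2
  refine cfc_congr fun t ht => ?_
  rw [spectrum_matOp] at ht
  simp only [Finset.sum_apply, Finset.sum_ite_eq]
  rcases eq_or_ne t 0 with rfl | h0
  · rw [if_neg (fun h => (mem_nonzeroEigenvalues.1 h).2 rfl), truncInv_zero]
  · rw [if_pos (mem_nonzeroEigenvalues.2 ⟨ht, h0⟩), truncInv_of_le hc (by linarith [hgap t ht h0])]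

theorem boundaryForm_eq (hab : a < b) (u : S.T₁.domain) (v : S.Ttilde₁.domain) :
    S.boundaryForm u v =
      ∑ l ∈ nonzeroEigenvalues (S.A b), l * scp (S.projValue u b l) (S.projValue v b l)
      - ∑ l ∈ nonzeroEigenvalues (S.A a), l * scp (S.projValue u a l) (S.projValue v a l) := by
  obtain ⟨w, hw⟩ := (mem_T₁_domain_iff _).1 u.2
  obtain ⟨z, hz⟩ := (mem_Ttilde₁_domain_iff _).1 v.2
  obtain ⟨p, hp⟩ := exists_isFlux hab hw
  obtain ⟨q, hq⟩ := exists_isFlux hab hz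
  obtain ⟨H, hH, hHae, hHint⟩ := hp.exists_continuousOn_inner hab hq
  obtain ⟨c, hc, hgap⟩ := exists_gap_zero (S.A b)
  obtain ⟨d, hd, hgap'⟩ := exists_gap_zero (S.A a)
  rw [boundaryForm_eq_integral hw hz, ← hHint,
    hp.boundary_value hab hq hH hHae (right_mem_Icc.2 hab.le) hc hgap,
    hp.boundary_value hab hq hH hHae (left_mem_Icc.2 hab.le) hd hgap',
    sum_projValue_eq hab hp hq (right_mem_Icc.2 hab.le) hc hgap,
    sum_projValue_eq hab hp hq (left_mem_Icc.2 hab.le) hd hgap']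

/-! ### The kernel of the boundary form and the domains of the closures -/

theorem conj_boundarySum (hab : a < b) (u v : L2Space a b r) {x₀ : ℝ} (hx₀ : x₀ ∈ Icc a b) :
    starRingEnd ℂ (∑ l ∈ nonzeroEigenvalues (S.A x₀),
        l * scp (S.projValue u x₀ l) (S.projValue v x₀ l))
      = ∑ l ∈ nonzeroEigenvalues (S.A x₀),
        l * scp (S.projValue v x₀ l) (S.projValue u x₀ l) := by
  rw [map_sum]
  refine Finset.sum_congr rfl fun l hl => ?_
  rw [map_mul, (isHermitian_A hab x₀ hx₀).conj_eq_of_mem_spectrum (mem_nonzeroEigenvalues.1 hl).1,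
    scp, scp, inner_conj_symm]

/-- A smooth function on the line, as an element of the graph space together with the values of its
flux. -/
theorem exists_isFlux_smooth (hab : a < b) (S : FriedrichsCoeff a b r) {ζ : ℝ → Cvec r}
    (hζ : ContDiff ℝ (⊤ : ℕ∞) ζ) :
    ∃ (v w : L2Space a b r) (q : ℝ → Cvec r), S.IsFlux v w q ∧
      ∀ x ∈ Icc a b, q x = matOp (S.A x) (ζ x) := by
  have hmem : ∀ {ζ : ℝ → Cvec r}, Continuous ζ → MemLp ζ 2 (intervalMeasure a b) := by
    intro ζ hζ
    obtain ⟨C, hC⟩ := isCompact_Icc.exists_bound_of_continuousOn (s := Icc a b) hζ.continuousOn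
    refine MemLp.of_bound hζ.aestronglyMeasurable C ?_
    filter_upwards [ae_restrict_mem measurableSet_Ioo] with x hx
    exact hC x (Ioo_subset_Icc_self hx)
  have hv := hmem hζ.continuous
  have hw : MemLp (fun x => mact (S.A x) (deriv ζ x) + mact (S.A' x) (ζ x)) 2
      (intervalMeasure a b) :=
    (memLp_mact S.memLp_A (hmem (hζ.continuous_deriv (by simp)))).add (memLp_mact S.memLp_A' hv)
  have hweak : IsWeakDeriv a b (fun x => mact (S.A x) (hv.toLp ζ x)) (hw.toLp _) := by
    refine (S.isWeakDeriv_mact_smooth hζ).congr_ae ?_ hw.coeFn_toLp.symm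
    filter_upwards [hv.coeFn_toLp] with x hx
    rw [hx]
  obtain ⟨q, hq⟩ := exists_isFlux hab hweak
  refine ⟨hv.toLp ζ, hw.toLp _, q, hq, ?_⟩
  refine eqOn_Icc_of_ae_eq hab hq.continuous.continuousOn
    ((continuousOn_matOp_A hab S).clm_apply hζ.continuous.continuousOn) ?_
  filter_upwards [hq.ae_eq, hv.coeFn_toLp] with x h1 h2
  rw [h1, h2, matOp_apply]

/-- At `x₀` the matrix `A * truncInv(A)` is the projection onto the range of `A`. The assumption
says that it kills `p x₀`, and every eigenprojection with `l ≠ 0` factors through it. -/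
theorem IsFlux.projValue_eq_zero (hab : a < b) {u w : L2Space a b r} {p : ℝ → Cvec r}
    (hu : S.IsFlux u w p) {x₀ : ℝ} (hx₀ : x₀ ∈ Icc a b) {c : ℝ} (hc : 0 < c)
    (hgap : ∀ ν ∈ spectrum ℂ (S.A x₀), ν ≠ 0 → 2 * c ≤ ‖ν‖)
    (h : ∀ y : Cvec r,
      inner ℂ (matOp (S.A x₀) y) (cfc (truncInv c) (matOp (S.A x₀)) (p x₀)) = 0)
    {l : ℂ} (hl : l ∈ nonzeroEigenvalues (S.A x₀)) : S.projValue u x₀ l = 0 := by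
  have hA := isHermitian_A (S := S) hab x₀ hx₀
  have h0 : (matOp (S.A x₀) * cfc (truncInv c) (matOp (S.A x₀))) (p x₀) = 0 := by
    refine ext_inner_left ℂ fun y => ?_
    rw [inner_zero_right, ← h y, matOp_apply, hA.inner_mact]
    rfl
  rw [← hA.cfc_id_mul] at h0
  have hl' := mem_nonzeroEigenvalues.1 hl
  have e : cfc (fun t => if t = l then l⁻¹ else 0) (matOp (S.A x₀))
      = cfc (fun t => if t = l then l⁻¹ else 0) (matOp (S.A x₀))
        * cfc (fun t => t * truncInv c t) (matOp (S.A x₀)) := by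
    rw [← cfc_matOp_mul]
    refine cfc_congr fun t ht => ?_
    by_cases htl : t = l
    · subst htl
      have := hgap t hl'.1 hl'.2
      simp only [if_true]
      rw [truncInv_of_le hc (by linarith), mul_inv_cancel₀ hl'.2, mul_one]
    · simp only [if_neg htl, zero_mul]
  rw [hu.projValue_eq hab hx₀ hl, e, mul_apply_eq_comp, h0, map_zero]

/-- Smooth functions on the closed interval belong to the graph space. Affine ones equal to a given
`y` at one end-point and zero at the other decouple the two boundary terms. -/
theorem projValue_eq_zero_of_boundaryForm (hab : a < b) (u : S.T₁.domain)
    (h : ∀ v, S.boundaryForm u v = 0) :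
    ∀ x ∈ ({a, b} : Set ℝ), ∀ l ∈ nonzeroEigenvalues (S.A x), S.projValue u x l = 0 := by
  obtain ⟨w, hw⟩ := (mem_T₁_domain_iff _).1 u.2
  obtain ⟨p, hp⟩ := exists_isFlux hab hw
  obtain ⟨c, hc, hgap⟩ := exists_gap_zero (S.A b)
  obtain ⟨d, hd, hgap'⟩ := exists_gap_zero (S.A a)
  have hba : b - a ≠ 0 := sub_ne_zero.2 hab.ne'
  have key : ∀ ζ : ℝ → Cvec r, ContDiff ℝ (⊤ : ℕ∞) ζ →
      inner ℂ (matOp (S.A b) (ζ b)) (cfc (truncInv c) (matOp (S.A b)) (p b))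
        - inner ℂ (matOp (S.A a) (ζ a)) (cfc (truncInv d) (matOp (S.A a)) (p a)) = 0 := by
    intro ζ hζ
    obtain ⟨v, z, q, hq, hval⟩ := exists_isFlux_smooth hab S hζ
    have h1 := h ⟨v, (mem_Ttilde₁_domain_iff v).2 ⟨z, hq.weakDeriv_A⟩⟩
    rw [boundaryForm_eq hab, sum_projValue_eq hab hp hq (right_mem_Icc.2 hab.le) hc hgap,
      sum_projValue_eq hab hp hq (left_mem_Icc.2 hab.le) hd hgap',
      hval b (right_mem_Icc.2 hab.le), hval a (left_mem_Icc.2 hab.le)] at h1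
    exact h1
  rintro x (rfl | rfl) l hl
  · refine hp.projValue_eq_zero hab (left_mem_Icc.2 hab.le) hd hgap' (fun y => ?_) hl
    have h1 := key (fun t => ((b - t) / (b - x)) • y) (by fun_prop)
    simpa [div_self hba] using h1
  · refine hp.projValue_eq_zero hab (right_mem_Icc.2 hab.le) hc hgap (fun y => ?_) hl
    have h1 := key (fun t => ((t - a) / (x - a)) • y) (by fun_prop)
    simpa [div_self hba] using h1

theorem boundaryForm_eq_zero_of_projValue (hab : a < b) (u : S.T₁.domain)
    (h : ∀ x ∈ ({a, b} : Set ℝ), ∀ l ∈ nonzeroEigenvalues (S.A x), S.projValue u x l = 0)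
    (v : S.Ttilde₁.domain) : S.boundaryForm u v = 0 := by
  rw [boundaryForm_eq hab, Finset.sum_eq_zero, Finset.sum_eq_zero, sub_self]
  · intro l hl
    rw [h a (by simp) l hl, scp, inner_zero_right, mul_zero]
  · intro l hl
    rw [h b (by simp) l hl, scp, inner_zero_right, mul_zero]

/-- The eigenvalues in the boundary formula are real, so the form is Hermitian. Hence its left and
right kernels coincide, and so do the domains of the two closures. -/
theorem boundaryForm_swap (hab : a < b) {u v : L2Space a b r} (hu : u ∈ S.T₁.domain)
    (hu' : u ∈ S.Ttilde₁.domain) (hv : v ∈ S.T₁.domain) (hv' : v ∈ S.Ttilde₁.domain) :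
    S.boundaryForm ⟨v, hv⟩ ⟨u, hu'⟩ = starRingEnd ℂ (S.boundaryForm ⟨u, hu⟩ ⟨v, hv'⟩) := by
  rw [boundaryForm_eq hab, boundaryForm_eq hab, map_sub,
    conj_boundarySum hab _ _ (right_mem_Icc.2 hab.le),
    conj_boundarySum hab _ _ (left_mem_Icc.2 hab.le)]

theorem T₀_domain_eq (hab : a < b) (S : FriedrichsCoeff a b r) :
    (S.T₀.domain : Set (L2Space a b r)) =
      {u | u ∈ S.graphSpace ∧ ∀ x ∈ ({a, b} : Set ℝ), ∀ l ∈ nonzeroEigenvalues (S.A x),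
        S.projValue u x l = 0} := by
  ext u
  rw [SetLike.mem_coe, mem_T₀_domain_iff]
  constructor
  · rintro ⟨hu, h⟩
    exact ⟨(mem_T₁_domain_iff u).1 hu, projValue_eq_zero_of_boundaryForm hab ⟨u, hu⟩ h⟩
  · rintro ⟨hu, h⟩
    exact ⟨(mem_T₁_domain_iff u).2 hu, boundaryForm_eq_zero_of_projValue hab ⟨u, _⟩ h⟩

theorem Ttilde₀_domain_eq (hab : a < b) (S : FriedrichsCoeff a b r) :
    S.Ttilde₀.domain = S.T₀.domain := by
  ext u
  rw [mem_T₀_domain_iff, mem_Ttilde₀_domain_iff]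
  constructor
  · rintro ⟨hu', h⟩
    have hu : u ∈ S.T₁.domain := (mem_T₁_domain_iff u).2 ((mem_Ttilde₁_domain_iff u).1 hu')
    refine ⟨hu, fun v => ?_⟩
    have hv : (v : L2Space a b r) ∈ S.T₁.domain :=
      (mem_T₁_domain_iff _).2 ((mem_Ttilde₁_domain_iff _).1 v.2)
    have h1 := h ⟨v, hv⟩
    rw [boundaryForm_swap hab hu hu' hv v.2] at h1
    exact (map_eq_zero _).1 h1
  · rintro ⟨hu, h⟩
    have hu' : u ∈ S.Ttilde₁.domain := (mem_Ttilde₁_domain_iff u).2 ((mem_T₁_domain_iff u).1 hu)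
    refine ⟨hu', fun v => ?_⟩
    have hv' : (v : L2Space a b r) ∈ S.Ttilde₁.domain :=
      (mem_Ttilde₁_domain_iff _).2 ((mem_T₁_domain_iff _).1 v.2)
    rw [boundaryForm_swap hab hu hu' v.2 hv', h, map_zero]

end FriedrichsCoeff

end

theorem lemma3p2 {a b : ℝ} (hab : a < b) {r : ℕ} (S : FriedrichsCoeff a b r) :
    -- the graph space is the common domain of `T₁` and `T̃₁`
    (S.T₁.domain : Set (L2Space a b r)) = S.graphSpace ∧
    (S.Ttilde₁.domain : Set (L2Space a b r)) = S.graphSpace ∧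
    -- the evaluations `(P_l u)(x)` at the end-points are well defined
    (∀ u ∈ S.graphSpace, ∀ x ∈ ({a, b} : Set ℝ), ∀ l ∈ nonzeroEigenvalues (S.A x),
      ∃! w : Cvec r, S.IsProjValue u x l w) ∧
    -- the boundary form
    (∀ (u : S.T₁.domain) (v : S.Ttilde₁.domain),
      S.boundaryForm u v =
        ∑ l ∈ nonzeroEigenvalues (S.A b), l * scp (S.projValue u b l) (S.projValue v b l)
        - ∑ l ∈ nonzeroEigenvalues (S.A a), l * scp (S.projValue u a l) (S.projValue v a l)) ∧
    -- the common domain of the closures `T₀` and `T̃₀`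
    (S.T₀.domain : Set (L2Space a b r)) =
      {u | u ∈ S.graphSpace ∧ ∀ x ∈ ({a, b} : Set ℝ), ∀ l ∈ nonzeroEigenvalues (S.A x),
        S.projValue u x l = 0} ∧
    (S.Ttilde₀.domain : Set (L2Space a b r)) =
      {u | u ∈ S.graphSpace ∧ ∀ x ∈ ({a, b} : Set ℝ), ∀ l ∈ nonzeroEigenvalues (S.A x),
        S.projValue u x l = 0} := by
  refine ⟨?_, ?_, ?_, S.boundaryForm_eq hab, S.T₀_domain_eq hab, ?_⟩
  · ext u
    exact S.mem_T₁_domain_iff u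
  · ext u
    exact S.mem_Ttilde₁_domain_iff u
  · rintro u ⟨w, hw⟩ x hx l hl
    obtain ⟨p, hp⟩ := S.exists_isFlux hab hw
    have hxI : x ∈ Icc a b := by
      rcases hx with rfl | rfl
      · exact left_mem_Icc.2 hab.le
      · exact right_mem_Icc.2 hab.le
    exact ⟨_, hp.isProjValue hab hxI hl, fun w' hw' => hw'.unique hab hxI hl
      (hp.isProjValue hab hxI hl)⟩
  · rw [S.Ttilde₀_domain_eq hab]
    exact S.T₀_domain_eq hab
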